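/- Let $p\ge 2$ and let $(X,\|\cdot\|)$ be a (real or complex) Banach space. $X$ is called *$p$-convex* if there are a norm $|||\cdot|||$ on $X$ equivalent to $\|\cdot\|$ and a constant $K>0$ such that $|||x|||=|||y|||=1$ implies $|||\frac{x+y}{2}|||\le 1-K|||x-y|||^p$. Given a Markov chain $(\xi_t)_{t\in\mathbb Z}$ on a state space $\Omega$ and $k\in\mathbb Z$, let $(\tilde\xi_t(k))_{t\in\mathbb Z}$ be the process that equals $\xi_t$ for $t\le k$ and evolves independently, with the same transition probabilities, for $t>k$. A metric space $(X,d)$ is *Markov $p$-convex with constant $\Pi\in[0,\infty)$* if for every Markov chain $(\xi_t)_{t\in\mathbb Z}$ on a state space $\Omega$ and every (measurable) $f:\Omega\to X$, $$\sum_{k=0}^\infty\sum_{t\in\mathbb Z}\frac{\mathbb E\left[d\big(f(\xi_t),f(\tilde\xi_t(t-2^k))\big)^p\right]}{2^{kp}}\le \Pi^p\sum_{t\in\mathbb Z}\mathbb E\left[d\big(f(\xi_t),f(\xi_{t-1})\big)^p\right],$$ and *Markov $p$-convex* if this holds for some $\Pi<\infty$. **Theorem.** 1. $X$ is $p$-convex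 if and only if it is Markov $p$-convex. 2. If $K>0$ and $2\|a\|^p+\frac{2}{K^p}\|b\|^p\le\|a+b\|^p+\|a-b\|^p$ for all $a,b\in X$, then $X$ is Markov $p$-convex with constant $4K$. 3. If $X$ is Markov $p$-convex with constant $\Pi>0$, then for every $\varepsilon\in(0,1)$ there is a norm $|||\cdot|||$ on $X$ such that for all $x,y\in X$ we have $(1-\varepsilon)\|x\|\le|||x|||\le\|x\|$ and $$\Big|\Big|\Big|\frac{x+y}{2}\Big|\Big|\Big|^p\le\frac{|||x|||^p+|||y|||^p}{2}-\frac{1-(1-\varepsilon)^p}{4\Pi^p(p+1)}\Big|\Big|\Big|\frac{x-y}{2}\Big|\Big|\Big|^p ,$$ and such that $2|||a|||^p+\frac{2}{K^p}|||b|||^p\le|||a+b|||^p+|||a-b|||^p$ for all $a,b\in X$ with $K=4\Pi/\varepsilon^{1/p}$ (so $K=O(\Pi/\varepsilon^{1/p})$ with an absolute constant). -/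

import Mathlib

open MeasureTheory ProbabilityTheory
open scoped ENNReal NNReal

universe u v w

/-! ### `p`-convexity of Banach spaces -/

section PConvex

variable {𝕜 X : Type*} [RCLike 𝕜] [NormedAddCommGroup X] [NormedSpace 𝕜 X]

/-- `N` is a norm on `X` equivalent to the given one: `a ‖x‖ ≤ N x ≤ b ‖x‖` for some `a, b > 0`.
(A seminorm with such a lower bound is a norm.) -/
def IsEquivalentNorm (N : Seminorm 𝕜 X) : Prop :=
  ∃ a b : ℝ, 0 < a ∧ 0 < b ∧ ∀ x : X, a * ‖x‖ ≤ N x ∧ N x ≤ b * ‖x‖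

/-- The modulus of uniform convexity of the norm `N` has power type `p` with constant `K`. -/
def HasPowerTypeModulus (N : Seminorm 𝕜 X) (p K : ℝ) : Prop :=
  ∀ x y : X, N x = 1 → N y = 1 → N ((2⁻¹ : 𝕜) • (x + y)) ≤ 1 - K * N (x - y) ^ p

/-- The two-point inequality of exponent `p` with constant `K` for the norm `N`. -/
def TwoPointInequality (N : Seminorm 𝕜 X) (p K : ℝ) : Prop :=
  ∀ a b : X, 2 * N a ^ p + 2 / K ^ p * N b ^ p ≤ N (a + b) ^ p + N (a - b) ^ p

end PConvex

/-- `X` is `p`-convex: it has an equivalent norm whose modulus of uniform convexity has power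
type `p`. -/
def IsPConvex (𝕜 : Type*) [RCLike 𝕜] (X : Type*) [NormedAddCommGroup X] [NormedSpace 𝕜 X]
    (p : ℝ) : Prop :=
  ∃ N : Seminorm 𝕜 X, IsEquivalentNorm N ∧ ∃ K : ℝ, 0 < K ∧ HasPowerTypeModulus N p K

/-! ### Markov chains and Markov convexity -/

section Markov

variable {S Ω : Type*} [MeasurableSpace S] [MeasurableSpace Ω]

/-- Under `P`, the process `X` is a (not necessarily time-homogeneous) Markov chain whose
transition probabilities from time `t` to time `t + 1` are given by `κ t`: conditional on the
whole past `(X s)_{s ≤ t}`, the law of `X (t + 1)` is `κ t (X t)`. -/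
structure IsMarkovChain (P : Measure S) (κ : ℤ → Kernel Ω Ω) (X : ℤ → S → Ω) : Prop where
  measurable : ∀ t, Measurable (X t)
  transition : ∀ t, HasCondDistrib (X (t + 1)) (fun ω (s : Set.Iic t) ↦ X s ω)
    ((κ t).comap (fun h : Set.Iic t → Ω ↦ h ⟨t, le_refl t⟩) (by fun_prop)) P

/-- `Y` equals `X` up to time `k`, and after time `k` it evolves with the transition probabilities
`κ`, independently of `X`: for `t ≥ k`, conditional on the whole process `X` and on
`(Y s)_{s ≤ t}`, the law of `Y (t + 1)` is `κ t (Y t)`. -/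
structure IsBranchedCopy (P : Measure S) (κ : ℤ → Kernel Ω Ω) (X : ℤ → S → Ω) (k : ℤ)
    (Y : ℤ → S → Ω) : Prop where
  measurable : ∀ t, Measurable (Y t)
  eq_of_le : ∀ t, t ≤ k → Y t = X t
  transition : ∀ t, k ≤ t →
    HasCondDistrib (Y (t + 1)) (fun ω ↦ ((fun s : ℤ ↦ X s ω), (fun s : Set.Iic t ↦ Y s ω)))
      ((κ t).comap (fun h : (ℤ → Ω) × (Set.Iic t → Ω) ↦ h.2 ⟨t, le_refl t⟩)
        (by fun_prop)) P

end Markov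

/-- The metric space `X` is Markov `p`-convex with constant `C`. The chain `ξ` lives on an arbitrary
measurable state space `Ω`, and `ξ' k t` is the copy, at time `t`, branched off at time `k`. The
map `f` is only asked to be measurable for the laws of the chain (no condition on a countable
discrete `Ω`). Both sides are sums of nonnegative terms in `[0, ∞]`. -/
def IsMarkovConvexWith (X : Type u) [MetricSpace X] (p : ℝ) (C : ℝ≥0) : Prop :=
  ∀ (Ω S : Type v) [MeasurableSpace Ω] [MeasurableSpace S]
    (P : Measure S) [IsProbabilityMeasure P]
    (κ : ℤ → Kernel Ω Ω) [∀ t, IsMarkovKernel (κ t)]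
    (ξ : ℤ → S → Ω) (ξ' : ℤ → ℤ → S → Ω),
    IsMarkovChain P κ ξ → (∀ k, IsBranchedCopy P κ ξ k (ξ' k)) →
    ∀ f : Ω → X, (∀ t, AEStronglyMeasurable f (P.map (ξ t))) →
      ∑' k : ℕ, ∑' t : ℤ,
          (∫⁻ ω, edist (f (ξ t ω)) (f (ξ' (t - 2 ^ k) t ω)) ^ p ∂P) / 2 ^ ((k : ℝ) * p)
        ≤ (C : ℝ≥0∞) ^ p * ∑' t : ℤ, ∫⁻ ω, edist (f (ξ t ω)) (f (ξ (t - 1) ω)) ^ p ∂P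

/-- The metric space `X` is Markov `p`-convex: its Markov `p`-convexity constant is finite. -/
def IsMarkovConvex (X : Type u) [MetricSpace X] (p : ℝ) : Prop :=
  ∃ C : ℝ≥0, IsMarkovConvexWith.{u, v} X p C

/-!
# `p`-convexity and Markov `p`-convexity of Banach spaces

**From `p`-convexity to Markov `p`-convexity.** A modulus of convexity of power type `p` gives a
two-point inequality for the same norm (`HasPowerTypeModulus.exists_twoPointInequality`). Applying
the latter to two pairs of consecutive increments yields the fork inequality
(`TwoPointInequality.fork`), which compares the sides of a fork `x — y`, `y — z`, `y — w` with the
distances `x — z`, `x — w`, `z — w`. With `x`, `y`, `z`, `w` the states of a Markov chain at times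
`t - 2 ^ (k + 1)`, `t - 2 ^ k`, `t` and the state at time `t` of the copy branched off at time
`t - 2 ^ k`, the expected fork inequality bounds the branching term of scale `k` by a difference of
two consecutive dyadic sums of distances along the chain, and the sum over `k` telescopes
(`tsum_branch_le_of_fork`). Passing to an equivalent norm only costs a constant
(`TwoPointInequality.isMarkovConvexWith`).

**From Markov `p`-convexity to `p`-convexity.** The only chains needed are random walks on the
leaves of a binary tree with vector labels (`DyadicTree.walk`): the leaves are visited in a random
order, the two subtrees of a node in the order decided by a fair coin, and the label of the visited
leaf is added to the current position. Whatever the coins, the steps of the walk are exactly the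
leaf labels. The coin of a node with `2 ^ k` leaves is tossed half a block before the node is
entered. A copy branched off at scale `k` therefore agrees with the walk about everything outside
that node and tosses an independent coin for it; with probability `1 / 2` walk and copy traverse
different subtrees, and by Jensen's inequality their distance is at least that of the averages of
these subtrees. So Markov convexity becomes the cotype inequality
`E ∑ ‖dMᵢ‖ ^ p ≤ 4 (p + 1) C ^ p E ‖M‖ ^ p` for dyadic martingales
(`DyadicTree.deviation_le_of_isMarkovConvexWith`). Pisier's renorming finishes the proof: let
`N x ^ p` be the infimum of `energy - lam * deviation` over the trees with mean `x`. Joining two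
trees at a new root shows the midpoint inequality, which together with homogeneity makes `N` a
seminorm, and the cotype inequality gives the lower bound for `N`
(`DyadicTree.exists_seminorm_of_deviation_le`, `IsMarkovConvexWith.exists_seminorm`).

The chains are realized on the countable product of fair coins. Their state is the history of all
coins tossed so far, so that the Markov property reduces to the independence of one coordinate of a
product measure from the others (`hasCondDistrib_of_update`), and all expectations are computed by
resampling a single coin (`lintegral_ite_coin`, `integral_ite_coin`).
-/

/-! ### From a four-point inequality to Markov convexity -/

section MarkovSum

variable {S Ω : Type*} [MeasurableSpace S] [MeasurableSpace Ω] {P : Measure S}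
  [IsProbabilityMeasure P] {κ : ℤ → Kernel Ω Ω} [∀ t, IsMarkovKernel (κ t)]
  {X Y : ℤ → S → Ω} {k s t : ℤ}

/-- A chain and a copy branched off at time `k` have the same joint law with the state at a
time `s ≤ k`. -/
theorem IsBranchedCopy.map_prodMk_eq (hX : IsMarkovChain P κ X) (hY : IsBranchedCopy P κ X k Y)
    (hs : s ≤ k) (ht : k ≤ t) :
    P.map (fun ω ↦ (X s ω, Y t ω)) = P.map (fun ω ↦ (X s ω, X t ω)) := by
  induction t, ht using Int.leInduction with
  | base => rw [hY.eq_of_le k le_rfl]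
  | succ t ht ih =>
    have mX := hX.measurable
    have mY := hY.measurable
    let K : Kernel (Ω × Ω) Ω := (κ t).comap Prod.snd measurable_snd
    have h1 : HasCondDistrib (Y (t + 1)) (fun ω ↦ (X s ω, Y t ω)) K P := by
      have h : HasCondDistrib (Y (t + 1)) (fun ω ↦ ((fun s ↦ X s ω), fun s : Set.Iic t ↦ Y s ω))
          (K.comap
            (fun h : (ℤ → Ω) × (Set.Iic t → Ω) ↦ (h.1 s, h.2 ⟨t, le_refl t⟩)) (by fun_prop)) P :=
        hY.transition t ht
      exact h.comp_right
    have h2 : HasCondDistrib (X (t + 1)) (fun ω ↦ (X s ω, X t ω)) K P := by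
      have h : HasCondDistrib (X (t + 1)) (fun ω (s : Set.Iic t) ↦ X s ω)
          (K.comap
            (fun h : Set.Iic t → Ω ↦ (h ⟨s, hs.trans ht⟩, h ⟨t, le_refl t⟩)) (by fun_prop)) P :=
        hX.transition t
      exact h.comp_right
    have h3 := h1.map_eq
    rw [ih, ← h2.map_eq] at h3
    have hg : Measurable (fun q : (Ω × Ω) × Ω ↦ (q.1.1, q.2)) := by fun_prop
    have h4 := congrArg (fun m ↦ m.map (fun q : (Ω × Ω) × Ω ↦ (q.1.1, q.2))) h3
    simp only at h4
    rw [Measure.map_map hg (by fun_prop), Measure.map_map hg (by fun_prop)] at h4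
    exact h4

theorem IsBranchedCopy.map_eq (hX : IsMarkovChain P κ X) (hY : IsBranchedCopy P κ X k Y)
    (ht : k ≤ t) : P.map (Y t) = P.map (X t) := by
  have mX := hX.measurable
  have mY := hY.measurable
  have h := congrArg (fun m ↦ m.map Prod.snd) (hY.map_prodMk_eq hX le_rfl ht)
  rwa [Measure.map_map measurable_snd (by fun_prop),
    Measure.map_map measurable_snd (by fun_prop)] at h

end MarkovSum

/-- Telescoping over the dyadic scales: if a nonnegative kernel `G` satisfies the four-point (fork)
inequality `hfork`, then along every Markov chain the branching sum of `G` is dominated by the sum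
of `G` over the steps of the chain. The sums `A k = ∑ₜ 𝔼 G(ξ_{t - 2^k}, ξ_t)` and the branching sums
`B k` at scale `2 ^ k` satisfy `a * A (k + 1) + b * B k ≤ A k`: apply the fork inequality at the
points `ξ_{t - 2^(k+1)}`, `ξ_{t - 2^k}`, `ξ_t` and the branched copy of `ξ_t`. -/
theorem tsum_branch_le_of_fork {S Ω : Type*} [MeasurableSpace S] [MeasurableSpace Ω]
    {P : Measure S} [IsProbabilityMeasure P] {κ : ℤ → Kernel Ω Ω} [∀ t, IsMarkovKernel (κ t)]
    {ξ : ℤ → S → Ω} {ξ' : ℤ → ℤ → S → Ω} (hξ : IsMarkovChain P κ ξ)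
    (hξ' : ∀ k, IsBranchedCopy P κ ξ k (ξ' k)) {E : Type*} [TopologicalSpace E]
    {f : Ω → E} (hf : ∀ t, AEStronglyMeasurable f (P.map (ξ t)))
    {G : E → E → ℝ≥0∞} (hG : Continuous (Function.uncurry G)) {a b : ℝ≥0∞}
    (hfork : ∀ x y z w, 2 * a * (G x z + G x w) + 4 * b * G z w ≤
      2 * G x y + (G y z + G y w)) :
    b * ∑' k : ℕ, a ^ k * ∑' t : ℤ, ∫⁻ ω, G (f (ξ t ω)) (f (ξ' (t - 2 ^ k) t ω)) ∂P ≤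
      ∑' t : ℤ, ∫⁻ ω, G (f (ξ (t - 1) ω)) (f (ξ t ω)) ∂P := by
  have mξ := hξ.measurable
  have mξ' := fun k ↦ (hξ' k).measurable
  have hfξ : ∀ t, AEStronglyMeasurable (fun ω ↦ f (ξ t ω)) P := fun t ↦
    (hf t).comp_measurable (mξ t)
  have hfξ' : ∀ k t, k ≤ t → AEStronglyMeasurable (fun ω ↦ f (ξ' k t ω)) P := fun k t h ↦
    AEStronglyMeasurable.comp_measurable (by rw [(hξ' k).map_eq hξ h]; exact hf t) (mξ' k t)
  have hGm : ∀ {g h : S → E}, AEStronglyMeasurable g P → AEStronglyMeasurable h P →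
      AEMeasurable (fun ω ↦ G (g ω) (h ω)) P := fun hg hh ↦
    (hG.comp_aestronglyMeasurable (hg.prodMk hh)).aemeasurable
  -- the copy may be replaced by the chain when paired with a state before the branching time
  have hlaw : ∀ s k t, s ≤ k → k ≤ t → ∫⁻ ω, G (f (ξ s ω)) (f (ξ' k t ω)) ∂P =
      ∫⁻ ω, G (f (ξ s ω)) (f (ξ t ω)) ∂P := by
    intro s k t hs ht
    have hm := (hξ' k).map_prodMk_eq hξ hs ht
    have hF : AEMeasurable (fun q : Ω × Ω ↦ G (f q.1) (f q.2))
        (P.map (fun ω ↦ (ξ s ω, ξ t ω))) := by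
      have h1 : AEStronglyMeasurable (fun q : Ω × Ω ↦ f q.1)
          (P.map (fun ω ↦ (ξ s ω, ξ t ω))) := by
        refine AEStronglyMeasurable.comp_measurable (g := f) ?_ measurable_fst
        rw [Measure.map_map measurable_fst (by fun_prop)]
        exact hf s
      have h2 : AEStronglyMeasurable (fun q : Ω × Ω ↦ f q.2)
          (P.map (fun ω ↦ (ξ s ω, ξ t ω))) := by
        refine AEStronglyMeasurable.comp_measurable (g := f) ?_ measurable_snd
        rw [Measure.map_map measurable_snd (by fun_prop)]
        exact hf t
      exact (hG.comp_aestronglyMeasurable (h1.prodMk h2)).aemeasurable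
    have e1 := lintegral_map' (μ := P) (g := fun ω ↦ (ξ s ω, ξ' k t ω))
      (f := fun q : Ω × Ω ↦ G (f q.1) (f q.2)) (by rwa [hm]) (by fun_prop)
    have e2 := lintegral_map' (μ := P) (g := fun ω ↦ (ξ s ω, ξ t ω)) hF (by fun_prop)
    rw [← e1, ← e2, hm]
  set A : ℕ → ℝ≥0∞ := fun k ↦ ∑' t : ℤ, ∫⁻ ω, G (f (ξ (t - 2 ^ k) ω)) (f (ξ t ω)) ∂P with hA
  set B : ℕ → ℝ≥0∞ := fun k ↦
    ∑' t : ℤ, ∫⁻ ω, G (f (ξ t ω)) (f (ξ' (t - 2 ^ k) t ω)) ∂P with hB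
  have hstep : ∀ k, a * A (k + 1) + b * B k ≤ A k := by
    intro k
    have hpt : ∀ t : ℤ,
        4 * (a * ∫⁻ ω, G (f (ξ (t - 2 ^ (k + 1)) ω)) (f (ξ t ω)) ∂P) +
          4 * (b * ∫⁻ ω, G (f (ξ t ω)) (f (ξ' (t - 2 ^ k) t ω)) ∂P) ≤
        2 * (∫⁻ ω, G (f (ξ (t - 2 ^ k - 2 ^ k) ω)) (f (ξ (t - 2 ^ k) ω)) ∂P) +
          2 * ∫⁻ ω, G (f (ξ (t - 2 ^ k) ω)) (f (ξ t ω)) ∂P := by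
      intro t
      have hk : (0 : ℤ) < 2 ^ k := by positivity
      have e : t - 2 ^ (k + 1) = t - 2 ^ k - 2 ^ k := by ring
      rw [e]
      set s := t - 2 ^ k - 2 ^ k with hs
      set r := t - 2 ^ k with hr
      have hsr : s ≤ r := by omega
      have hrt : r ≤ t := by omega
      have m1 := hGm (hfξ s) (hfξ t)
      have m2 := hGm (hfξ s) (hfξ' r t hrt)
      have m3 := hGm (hfξ t) (hfξ' r t hrt)
      have m4 := hGm (hfξ s) (hfξ r)
      have m5 := hGm (hfξ r) (hfξ t)
      have m12 : AEMeasurable (fun ω ↦ G (f (ξ s ω)) (f (ξ t ω)) + G (f (ξ s ω)) (f (ξ' r t ω)))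
          P := m1.add m2
      have := lintegral_mono (μ := P) fun ω ↦
        hfork (f (ξ s ω)) (f (ξ r ω)) (f (ξ t ω)) (f (ξ' r t ω))
      rw [lintegral_add_left' (m12.const_mul _), lintegral_const_mul'' _ m12,
        lintegral_add_left' m1, lintegral_const_mul'' _ m3, lintegral_add_left' (m4.const_mul _),
        lintegral_const_mul'' _ m4, lintegral_add_left' m5, hlaw s r t hsr hrt,
        hlaw r r t le_rfl hrt] at this
      calc _ = _ := ?_
        _ ≤ _ := this
        _ = _ := ?_
      · ring
      · ring
    have hsum := ENNReal.tsum_le_tsum hpt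
    rw [ENNReal.tsum_add, ENNReal.tsum_add, ENNReal.tsum_mul_left, ENNReal.tsum_mul_left,
      ENNReal.tsum_mul_left, ENNReal.tsum_mul_left, ENNReal.tsum_mul_left,
      ENNReal.tsum_mul_left] at hsum
    have hshift : ∑' t : ℤ, ∫⁻ ω, G (f (ξ (t - 2 ^ k - 2 ^ k) ω)) (f (ξ (t - 2 ^ k) ω)) ∂P =
        A k := (Equiv.subRight ((2 : ℤ) ^ k)).tsum_eq
          (fun t ↦ ∫⁻ ω, G (f (ξ (t - 2 ^ k) ω)) (f (ξ t ω)) ∂P)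
    rw [hshift] at hsum
    have h4 : 4 * (a * A (k + 1) + b * B k) ≤ 4 * A k := by
      calc _ = _ := ?_
        _ ≤ _ := hsum
        _ = _ := ?_
      · rw [mul_add]
      · rw [← add_mul]; norm_num
    exact (ENNReal.mul_le_mul_iff_right (by norm_num) (by norm_num)).1 h4
  have hind : ∀ n, a ^ n * A n + b * ∑ k ∈ Finset.range n, a ^ k * B k ≤ A 0 := by
    intro n
    induction n with
    | zero => simp
    | succ n ih =>
      refine le_trans ?_ ih
      rw [Finset.sum_range_succ]
      calc a ^ (n + 1) * A (n + 1) + b * (∑ k ∈ Finset.range n, a ^ k * B k + a ^ n * B n)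
          = a ^ n * (a * A (n + 1) + b * B n) + b * ∑ k ∈ Finset.range n, a ^ k * B k := by ring
        _ ≤ _ := by gcongr; exact hstep n
  have h0 : A 0 = ∑' t : ℤ, ∫⁻ ω, G (f (ξ (t - 1) ω)) (f (ξ t ω)) ∂P := by
    simp only [hA, pow_zero]
  rw [← h0, ← ENNReal.tsum_mul_left]
  refine ENNReal.tsum_le_of_sum_range_le fun n ↦ ?_
  rw [← Finset.mul_sum]
  exact le_trans le_add_self (hind n)

/-! ### Resampling one coordinate of a product measure -/

section Resample

variable {ι : Type*} [DecidableEq ι] {E : Type*} [MeasurableSpace E]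

theorem measurable_update_uncurry (i : ι) :
    Measurable (fun q : (ι → E) × E ↦ Function.update q.1 i q.2) := by
  refine measurable_pi_lambda _ fun j ↦ ?_
  by_cases h : j = i
  · subst h; simpa using measurable_snd
  · simp only [Function.update_of_ne h]; fun_prop

/-- Replacing one coordinate by an independent copy does not change an i.i.d. product measure. -/
theorem measurePreserving_update_infinitePi (ν : Measure E) [IsProbabilityMeasure ν] (i : ι) :
    MeasurePreserving (fun q : (ι → E) × E ↦ Function.update q.1 i q.2)
      ((Measure.infinitePi fun _ : ι ↦ ν).prod ν) (Measure.infinitePi fun _ : ι ↦ ν) := by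
  refine ⟨measurable_update_uncurry i, ?_⟩
  refine Measure.eq_infinitePi _ fun s t ht ↦ ?_
  rw [Measure.map_apply (measurable_update_uncurry i)
    (MeasurableSet.pi s.countable_toSet fun j _ ↦ ht j)]
  by_cases hi : i ∈ s
  · have : (fun q : (ι → E) × E ↦ Function.update q.1 i q.2) ⁻¹' (Set.pi s t) =
        (Set.pi (s.erase i : Finset ι) t) ×ˢ (t i) := by
      ext q
      simp only [Set.mem_preimage, Set.mem_pi, Finset.mem_coe, Set.mem_prod, Finset.mem_erase]
      constructor
      · intro h
        refine ⟨fun j hj ↦ ?_, by simpa using h i hi⟩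
        simpa [Function.update_of_ne hj.1] using h j hj.2
      · rintro ⟨h1, h2⟩ j hj
        by_cases hji : j = i
        · subst hji; simpa using h2
        · simpa [Function.update_of_ne hji] using h1 j ⟨hji, hj⟩
    rw [this, Measure.prod_prod, Measure.infinitePi_pi _ (fun j _ ↦ ht j),
      Finset.prod_erase_mul _ _ hi]
  · have : (fun q : (ι → E) × E ↦ Function.update q.1 i q.2) ⁻¹' (Set.pi s t) =
        (Set.pi s t) ×ˢ Set.univ := by
      ext q
      simp only [Set.mem_preimage, Set.mem_pi, Finset.mem_coe, Set.mem_prod, Set.mem_univ, and_true]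
      refine forall₂_congr fun j hj ↦ ?_
      have hji : j ≠ i := fun h ↦ hi (h ▸ hj)
      rw [Function.update_of_ne hji]
    rw [this, Measure.prod_prod, Measure.infinitePi_pi _ (fun j _ ↦ ht j), measure_univ, mul_one]

/-- If `Z` does not depend on the coordinate `i`, then the conditional distribution given `Z` of a
function `φ (Z, ω i)` is the image of the law of `ω i` under `φ (Z, ·)`. -/
theorem hasCondDistrib_of_update {ν : Measure E} [IsProbabilityMeasure ν] {i : ι}
    {A B : Type*} [MeasurableSpace A] [MeasurableSpace B] {Z : (ι → E) → A} (hZ : Measurable Z)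
    (hinv : ∀ ω e, Z (Function.update ω i e) = Z ω) {φ : A × E → B} (hφ : Measurable φ)
    {K : Kernel A B} [IsMarkovKernel K] (hK : ∀ a, K a = ν.map (fun e ↦ φ (a, e))) :
    HasCondDistrib (fun ω ↦ φ (Z ω, ω i)) Z K (Measure.infinitePi fun _ : ι ↦ ν) := by
  have hm : (Measure.infinitePi fun _ : ι ↦ ν).map (fun ω ↦ (Z ω, ω i)) =
      ((Measure.infinitePi fun _ : ι ↦ ν).map Z).prod ν := by
    nth_rw 1 [← (measurePreserving_update_infinitePi ν i).map_eq]
    rw [Measure.map_map (by fun_prop) (measurable_update_uncurry i)]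
    have : (fun ω ↦ (Z ω, ω i)) ∘ (fun q : (ι → E) × E ↦ Function.update q.1 i q.2) =
        Prod.map Z id := by
      ext q <;> simp [hinv]
    rw [this, ← Measure.map_prod_map _ _ hZ measurable_id, Measure.map_id]
  refine ⟨by fun_prop, ?_⟩
  have hmap : (fun ω : ι → E ↦ (Z ω, φ (Z ω, ω i))) =
      (fun q : A × E ↦ (q.1, φ q)) ∘ (fun ω ↦ (Z ω, ω i)) := rfl
  rw [hmap, ← Measure.map_map (by fun_prop) (by fun_prop), hm]
  have : IsProbabilityMeasure ((Measure.infinitePi fun _ : ι ↦ ν).map Z) :=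
    Measure.isProbabilityMeasure_map hZ.aemeasurable
  ext s hs
  rw [Measure.map_apply (by fun_prop) hs, Measure.compProd_apply hs,
    Measure.prod_apply (hs.preimage (by fun_prop))]
  refine lintegral_congr fun a ↦ ?_
  have hs' : MeasurableSet (Prod.mk a ⁻¹' s) := hs.preimage (by fun_prop)
  rw [hK, Measure.map_apply (by fun_prop) hs']
  rfl

end Resample

/-! ### The chain of coin histories -/

section History

variable {E : Type v}

/-- The state at time `t` of the chain that records all innovations `c u` with `u ≤ t`, together
with the time. The entries after time `t` carry a default value. -/
def historyState [Inhabited E] (c : ℤ → E) (t : ℤ) : ℤ × (ℤ → E) :=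
  (t, fun u ↦ if u ≤ t then c u else default)

/-- One step of the history chain: the innovation `e` is recorded. -/
def appendHistory (q : (ℤ × (ℤ → E)) × E) : ℤ × (ℤ → E) :=
  (q.1.1 + 1, fun u ↦ if u = q.1.1 + 1 then q.2 else q.1.2 u)

theorem historyState_succ [Inhabited E] (c : ℤ → E) (t : ℤ) :
    historyState c (t + 1) = appendHistory (historyState c t, c (t + 1)) := by
  refine Prod.ext rfl (funext fun u ↦ ?_)
  change (if u ≤ t + 1 then c u else default) =
    if u = t + 1 then c (t + 1) else if u ≤ t then c u else default
  rcases lt_trichotomy u (t + 1) with h | h | h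
  · rw [if_pos h.le, if_neg h.ne, if_pos (by omega)]
  · rw [if_pos h.le, if_pos h, h]
  · rw [if_neg (by omega), if_neg h.ne', if_neg (by omega)]

theorem measurable_historyState [MeasurableSpace E] [Inhabited E] (t : ℤ) :
    Measurable (fun c : ℤ → E ↦ historyState c t) := by
  refine Measurable.prodMk measurable_const (measurable_pi_lambda _ fun u ↦ ?_)
  by_cases h : u ≤ t
  · simp only [h, if_true]; fun_prop
  · simp only [h, if_false]; fun_prop

theorem measurable_appendHistory [MeasurableSpace E] : Measurable (appendHistory (E := E)) := by
  refine Measurable.prodMk (by fun_prop) (measurable_pi_lambda _ fun u ↦ ?_)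
  refine Measurable.ite ?_ (by fun_prop) (by fun_prop)
  exact measurableSet_eq_fun (f := fun _ ↦ u) measurable_const (by fun_prop)

/-- The transition kernel of the history chain with innovations of law `ν`. -/
noncomputable def historyKernel [MeasurableSpace E] (ν : Measure E) : Kernel (ℤ × (ℤ → E)) (ℤ × (ℤ → E)) :=
  (Kernel.id ×ₖ Kernel.const _ ν).map appendHistory

instance [MeasurableSpace E] (ν : Measure E) [IsProbabilityMeasure ν] : IsMarkovKernel (historyKernel ν) :=
  Kernel.IsMarkovKernel.map _ measurable_appendHistory

theorem historyKernel_apply [MeasurableSpace E] (ν : Measure E) [IsProbabilityMeasure ν] (q : ℤ × (ℤ → E)) :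
    historyKernel ν q = ν.map (fun e ↦ appendHistory (q, e)) := by
  rw [historyKernel, Kernel.map_apply _ measurable_appendHistory, Kernel.prod_apply,
    Kernel.id_apply, Kernel.const_apply, Measure.dirac_prod,
    Measure.map_map measurable_appendHistory (by fun_prop)]
  rfl

/-- The innovations of the copy branched off at time `k`: the original ones up to time `k`, fresh
ones afterwards. -/
def splice (k : ℤ) (ω : ℤ ⊕ ℤ → E) (u : ℤ) : E :=
  if u ≤ k then ω (Sum.inl u) else ω (Sum.inr u)

theorem measurable_splice [MeasurableSpace E] (k : ℤ) : Measurable (splice (E := E) k) := by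
  refine measurable_pi_lambda _ fun u ↦ ?_
  unfold splice
  by_cases h : u ≤ k
  · simp only [h, if_true]; fun_prop
  · simp only [h, if_false]; fun_prop

theorem isMarkovChain_history [MeasurableSpace E] [Inhabited E] (ν : Measure E) [IsProbabilityMeasure ν] :
    IsMarkovChain (Measure.infinitePi fun _ : ℤ ⊕ ℤ ↦ ν) (fun _ ↦ historyKernel ν)
      (fun t ω ↦ historyState (fun u ↦ ω (Sum.inl u)) t) where
  measurable t := (measurable_historyState t).comp (by fun_prop)
  transition t := by
    have hZ : Measurable (fun (ω : ℤ ⊕ ℤ → E) (s : Set.Iic t) ↦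
        historyState (fun u ↦ ω (Sum.inl u)) s) :=
      measurable_pi_lambda _ fun s ↦ (measurable_historyState _).comp (by fun_prop)
    have h := hasCondDistrib_of_update (ν := ν) (i := (Sum.inl (t + 1) : ℤ ⊕ ℤ)) hZ
      ?_ (hK := fun _ ↦ historyKernel_apply ν _)
      (K := (historyKernel ν).comap
        (fun h : Set.Iic t → ℤ × (ℤ → E) ↦ h ⟨t, le_refl t⟩) (by fun_prop))
      (φ := fun q : (Set.Iic t → ℤ × (ℤ → E)) × E ↦ appendHistory (q.1 ⟨t, le_refl t⟩, q.2))
      (measurable_appendHistory.comp (by fun_prop))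
    · convert h using 1
      funext ω
      exact historyState_succ _ t
    · intro ω e
      funext s
      refine Prod.ext rfl (funext fun u ↦ ?_)
      have hs : (s : ℤ) ≤ t := s.2
      simp only [historyState]
      split_ifs with hu
      · exact Function.update_of_ne (by simp; omega) _ _
      · rfl

theorem isBranchedCopy_history [MeasurableSpace E] [Inhabited E] (ν : Measure E) [IsProbabilityMeasure ν] (k : ℤ) :
    IsBranchedCopy (Measure.infinitePi fun _ : ℤ ⊕ ℤ ↦ ν) (fun _ ↦ historyKernel ν)
      (fun t ω ↦ historyState (fun u ↦ ω (Sum.inl u)) t) k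
      (fun t ω ↦ historyState (splice k ω) t) where
  measurable t := (measurable_historyState t).comp (measurable_splice k)
  eq_of_le t ht := by
    funext ω
    refine Prod.ext rfl (funext fun u ↦ ?_)
    simp only [historyState, splice]
    split_ifs with h1 h2
    · rfl
    · omega
    · rfl
  transition t ht := by
    have hZ : Measurable (fun (ω : ℤ ⊕ ℤ → E) ↦
        ((fun s : ℤ ↦ historyState (fun u ↦ ω (Sum.inl u)) s),
          (fun s : Set.Iic t ↦ historyState (splice k ω) s))) :=
      (measurable_pi_lambda _ fun s ↦ (measurable_historyState _).comp (by fun_prop)).prodMk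
        (measurable_pi_lambda _ fun s ↦ (measurable_historyState _).comp (measurable_splice k))
    have h := hasCondDistrib_of_update (ν := ν) (i := (Sum.inr (t + 1) : ℤ ⊕ ℤ)) hZ
      ?_ (hK := fun _ ↦ historyKernel_apply ν _)
      (K := (historyKernel ν).comap
        (fun h : (ℤ → ℤ × (ℤ → E)) × (Set.Iic t → ℤ × (ℤ → E)) ↦ h.2 ⟨t, le_refl t⟩) (by fun_prop))
      (φ := fun q : ((ℤ → ℤ × (ℤ → E)) × (Set.Iic t → ℤ × (ℤ → E))) × E ↦
        appendHistory (q.1.2 ⟨t, le_refl t⟩, q.2))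
      (measurable_appendHistory.comp (by fun_prop))
    · convert h using 1
      funext ω
      rw [historyState_succ]
      simp only [splice, if_neg (show ¬ t + 1 ≤ k by omega)]
    · intro ω e
      refine Prod.ext (funext fun s ↦ ?_) (funext fun s ↦ ?_)
      · refine Prod.ext rfl (funext fun u ↦ ?_)
        simp [historyState]
      · have hs : (s : ℤ) ≤ t := s.2
        refine Prod.ext rfl (funext fun u ↦ ?_)
        simp only [historyState, splice]
        split_ifs with hu hk
        · exact Function.update_of_ne (by simp) _ _
        · exact Function.update_of_ne (by simp; omega) _ _
        · rfl

end History

/-! ### Fair coins -/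

/-- The law of a fair coin. Coins live in `ULift Bool` so that the universe is free. -/
noncomputable def fairCoin : Measure (ULift.{v} Bool) :=
  (2⁻¹ : ℝ≥0∞) • (Measure.dirac ⟨true⟩ + Measure.dirac ⟨false⟩)

instance : IsProbabilityMeasure fairCoin.{v} where
  measure_univ := by
    simp only [fairCoin, Measure.smul_apply, Measure.add_apply, measure_univ, smul_eq_mul]
    rw [one_add_one_eq_two, ENNReal.inv_mul_cancel (by norm_num) (by norm_num)]

instance : MeasurableSingletonClass (ULift.{v} Bool) where
  measurableSet_singleton x := by
    have : {x} = ULift.down ⁻¹' {x.down} := by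
      ext y
      exact ⟨congrArg _, ULift.ext y x⟩
    rw [this]
    exact measurable_down (measurableSet_singleton _)

section Coin

variable {ι : Type*} [DecidableEq ι] {i : ι}

theorem measurableSet_coin {ι : Type*} (i : ι) : MeasurableSet {ω : ι → ULift.{v} Bool | (ω i).down = true} :=
  (measurable_down.comp (measurable_pi_apply i)) (measurableSet_singleton true)

theorem lintegral_ite_coin {H₁ H₀ : (ι → ULift.{v} Bool) → ℝ≥0∞} (h₁ : Measurable H₁)
    (h₀ : Measurable H₀) (i₁ : ∀ ω e, H₁ (Function.update ω i e) = H₁ ω)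
    (i₀ : ∀ ω e, H₀ (Function.update ω i e) = H₀ ω) :
    ∫⁻ ω, (if (ω i).down = true then H₁ ω else H₀ ω) ∂(Measure.infinitePi fun _ ↦ fairCoin) =
      2⁻¹ * ((∫⁻ ω, H₁ ω ∂(Measure.infinitePi fun _ ↦ fairCoin)) +
        ∫⁻ ω, H₀ ω ∂(Measure.infinitePi fun _ ↦ fairCoin)) := by
  have hm : Measurable (fun ω ↦ if (ω i).down = true then H₁ ω else H₀ ω) :=
    Measurable.ite (measurableSet_coin i) h₁ h₀
  have hp := lintegral_prod _ (μ := Measure.infinitePi fun _ : ι ↦ fairCoin.{v}) (ν := fairCoin)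
    (hm.comp (measurable_update_uncurry i)).aemeasurable
  simp only [Function.comp_apply] at hp
  rw [← (measurePreserving_update_infinitePi fairCoin i).lintegral_comp hm, hp,
    ← lintegral_add_left h₁, ← lintegral_const_mul _ (show Measurable (fun ω ↦ H₁ ω + H₀ ω) from h₁.add h₀)]
  refine lintegral_congr fun ω ↦ ?_
  simp only [i₁, i₀, Function.update_self]
  rw [fairCoin, lintegral_smul_measure, lintegral_add_measure, lintegral_dirac, lintegral_dirac]
  simp

theorem integral_ite_coin {X : Type*} [NormedAddCommGroup X] [NormedSpace ℝ X] [CompleteSpace X]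
    {H₁ H₀ : (ι → ULift.{v} Bool) → X}
    (h₁ : Integrable H₁ (Measure.infinitePi fun _ ↦ fairCoin))
    (h₀ : Integrable H₀ (Measure.infinitePi fun _ ↦ fairCoin))
    (i₁ : ∀ ω e, H₁ (Function.update ω i e) = H₁ ω)
    (i₀ : ∀ ω e, H₀ (Function.update ω i e) = H₀ ω) :
    ∫ ω, (if (ω i).down = true then H₁ ω else H₀ ω) ∂(Measure.infinitePi fun _ ↦ fairCoin) =
      (2⁻¹ : ℝ) • ((∫ ω, H₁ ω ∂(Measure.infinitePi fun _ ↦ fairCoin)) +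
        ∫ ω, H₀ ω ∂(Measure.infinitePi fun _ ↦ fairCoin)) := by
  set P : Measure (ι → ULift.{v} Bool) := Measure.infinitePi fun _ ↦ fairCoin
  have hF : Integrable (fun ω ↦ if (ω i).down = true then H₁ ω else H₀ ω) P := by
    change Integrable (Set.piecewise {ω | (ω i).down = true} H₁ H₀) P
    exact Integrable.piecewise (measurableSet_coin i) h₁.integrableOn h₀.integrableOn
  have hmp := measurePreserving_update_infinitePi fairCoin.{v} i
  have hF' := hmp.integrable_comp_of_integrable hF
  have e1 : ∫ ω, (if (ω i).down = true then H₁ ω else H₀ ω) ∂P =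
      ∫ q, (if (Function.update q.1 i q.2 i).down = true then H₁ (Function.update q.1 i q.2)
        else H₀ (Function.update q.1 i q.2)) ∂(P.prod fairCoin) := by
    have := integral_map (μ := P.prod fairCoin) hmp.measurable.aemeasurable
      (f := fun ω ↦ if (ω i).down = true then H₁ ω else H₀ ω)
      (by rw [hmp.map_eq]; exact hF.aestronglyMeasurable)
    rwa [hmp.map_eq] at this
  have e2 := integral_prod _ hF'
  simp only [Function.comp_apply] at e2
  rw [e1, e2, ← integral_add h₁ h₀, ← integral_smul]
  refine integral_congr_ae (.of_forall fun ω ↦ ?_)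
  simp only [i₁, i₀, Function.update_self]
  rw [fairCoin, integral_smul_measure, integral_add_measure, integral_dirac, integral_dirac]
  · simp
  · exact Integrable.of_finite
  · exact Integrable.of_finite

end Coin

/-! ### Dyadic trees and their random walks -/

/-- Binary trees with leaves in `X`. They encode the dyadic (Walsh–Paley) martingales that move from
a node to a uniformly chosen child. -/
inductive DyadicTree (X : Type*) where
  | leaf (x : X) : DyadicTree X
  | node (l r : DyadicTree X) : DyadicTree X

namespace DyadicTree

/-- The number of edges on a longest branch. -/
def depth {X : Type*} : DyadicTree X → ℕ
  | leaf _ => 0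
  | node l r => max l.depth r.depth + 1

/-- The label of the root when every inner node carries the average of its children. -/
noncomputable def mean {X : Type*} [AddCommGroup X] [Module ℝ X] : DyadicTree X → X
  | leaf x => x
  | node l r => (2⁻¹ : ℝ) • (l.mean + r.mean)

/-- The expectation of `‖x‖ ^ p` at the random leaf `x` reached by the dyadic martingale. -/
noncomputable def energy {X : Type*} [Norm X] (p : ℝ) : DyadicTree X → ℝ
  | leaf x => ‖x‖ ^ p
  | node l r => (l.energy p + r.energy p) / 2

/-- The expectation of the sum of the `p`-th powers of the increments of the dyadic martingale. -/
noncomputable def deviation {X : Type*} [NormedAddCommGroup X] [Module ℝ X] (p : ℝ) :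
    DyadicTree X → ℝ
  | leaf _ => 0
  | node l r => (l.deviation p + r.deviation p) / 2 + ‖(2⁻¹ : ℝ) • (l.mean - r.mean)‖ ^ p

theorem energy_nonneg {X : Type*} [NormedAddCommGroup X] (p : ℝ) (T : DyadicTree X) :
    0 ≤ T.energy p := by
  induction T with
  | leaf x => exact Real.rpow_nonneg (norm_nonneg _) _
  | node l r hl hr => rw [energy]; positivity

theorem deviation_nonneg {X : Type*} [NormedAddCommGroup X] [Module ℝ X] (p : ℝ)
    (T : DyadicTree X) : 0 ≤ T.deviation p := by
  induction T with
  | leaf x => exact le_rfl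
  | node l r hl hr => rw [deviation]; positivity

/-- The walk that traverses the leaves of a tree in a random order, at time `t`. The tree occupies
the time interval `[b, b + 2 ^ m]`, during which each subtree at depth `d` is visited once, for a
time `2 ^ (m - d)`; a leaf label is the increment per unit of time. The order in which the two
subtrees of a tree at level `m + 1` are visited is decided by the coin `c (b - 2 ^ m + 1)`, tossed
half a block before the start: so a copy branched off `2 ^ (m + 1)` before a time of the first
half of the block uses an independent coin, while branching off at most `2 ^ m` before a time of the
block keeps the coin. A tree deeper than `m` is cut with a junk value. -/
noncomputable def walk {X : Type*} [AddCommGroup X] [Module ℝ X] :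
    DyadicTree X → ℕ → ℤ → (ℤ → ULift.{v} Bool) → ℤ → X
  | leaf x, m, b, _, t => ((max 0 (min (t - b) (2 ^ m)) : ℤ) : ℝ) • x
  | node _ _, 0, _, _, _ => 0
  | node l r, m + 1, b, c, t =>
    if (c (b - 2 ^ m + 1)).down = true then l.walk m b c t + r.walk m (b + 2 ^ m) c t
    else r.walk m b c t + l.walk m (b + 2 ^ m) c t

section Walk

variable {X : Type*} [AddCommGroup X] [Module ℝ X]

theorem walk_of_le (T : DyadicTree X) {m : ℕ} {b t : ℤ} (c : ℤ → ULift.{v} Bool) (h : t ≤ b) :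
    T.walk m b c t = 0 := by
  induction T generalizing m b with
  | leaf x =>
    have : max 0 (min (t - b) (2 ^ m)) = 0 := max_eq_left ((min_le_left _ _).trans (by omega))
    rw [walk, this, Int.cast_zero, zero_smul]
  | node l r hl hr =>
    cases m with
    | zero => rfl
    | succ m =>
      have h2 : (0 : ℤ) < 2 ^ m := by positivity
      rw [walk, hl h, hr h, hl (b := b + 2 ^ m) (by omega), hr (b := b + 2 ^ m) (by omega)]
      simp

theorem walk_of_ge (T : DyadicTree X) {m : ℕ} {b t : ℤ} (c : ℤ → ULift.{v} Bool)
    (hm : T.depth ≤ m) (h : b + 2 ^ m ≤ t) : T.walk m b c t = (2 ^ m : ℝ) • T.mean := by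
  induction T generalizing m b with
  | leaf x =>
    have h2 : (0 : ℤ) < 2 ^ m := by positivity
    have : max 0 (min (t - b) (2 ^ m)) = 2 ^ m := by
      rw [min_eq_right (by omega), max_eq_right h2.le]
    rw [walk, this, mean]
    push_cast
    rfl
  | node l r hl hr =>
    cases m with
    | zero => simp [depth] at hm
    | succ m =>
      have h2 : (0 : ℤ) < 2 ^ m := by positivity
      rw [pow_succ] at h
      rw [depth] at hm
      have hml : l.depth ≤ m := by omega
      have hmr : r.depth ≤ m := by omega
      rw [walk, hl (b := b) hml (by omega), hr (b := b) hmr (by omega), hl (b := b + 2 ^ m) hml (by omega),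
        hr (b := b + 2 ^ m) hmr (by omega), mean, smul_smul, pow_succ, mul_assoc,
        mul_inv_cancel₀ two_ne_zero, mul_one, smul_add, add_comm ((2 ^ m : ℝ) • r.mean), ite_self]

/-- The walk at time `t` only depends on the coins up to time `t` that decide about proper
subtrees or about the tree itself. -/
theorem walk_congr (T : DyadicTree X) {m : ℕ} {b t : ℤ} {c c' : ℤ → ULift.{v} Bool}
    (h : ∀ u, b - 2 ^ m + 1 < u → u ≤ t → c u = c' u) : T.walk m b c t = T.walk m b c' t := by
  induction T generalizing m b with
  | leaf x => rfl
  | node l r hl hr =>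
    cases m with
    | zero => rfl
    | succ m =>
      have h2 : (0 : ℤ) < 2 ^ m := by positivity
      rw [pow_succ] at h
      by_cases ht : b - 2 ^ m + 1 ≤ t
      · rw [walk, walk, h _ (by omega) ht, hl (b := b) fun u h1 h2 ↦ h u (by omega) h2,
          hr (b := b) fun u h1 h2 ↦ h u (by omega) h2,
          hl (b := b + 2 ^ m) fun u h1 h2 ↦ h u (by omega) h2,
          hr (b := b + 2 ^ m) fun u h1 h2 ↦ h u (by omega) h2]
      · rw [walk_of_le _ _ (by omega), walk_of_le _ _ (by omega)]

/-- The walk of a subtree of level `m` starting at time `a` does not involve a coin tossed at a time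
`n ≤ a - 2 ^ m + 1`. -/
theorem walk_update (T : DyadicTree X) {ι : Type*} [DecidableEq ι] {j : ℤ → ι}
    (hj : Function.Injective j) {m : ℕ} {a n t : ℤ} (hn : n ≤ a - 2 ^ m + 1)
    (ω : ι → ULift.{v} Bool) (e : ULift.{v} Bool) :
    T.walk m a (fun u ↦ Function.update ω (j n) e (j u)) t = T.walk m a (fun u ↦ ω (j u)) t :=
  T.walk_congr fun u hu _ ↦ Function.update_of_ne (hj.ne (by omega)) _ _

end Walk

section Measurability

variable {X : Type*} [NormedAddCommGroup X] [NormedSpace ℝ X]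

theorem stronglyMeasurable_walk_uncurry (T : DyadicTree X) (m : ℕ) (b : ℤ) :
    StronglyMeasurable (fun q : ℤ × (ℤ → ULift.{v} Bool) ↦ T.walk m b q.2 q.1) := by
  induction T generalizing m b with
  | leaf x =>
    exact (StronglyMeasurable.of_discrete
      (f := fun t : ℤ ↦ ((max 0 (min (t - b) (2 ^ m)) : ℤ) : ℝ) • x)).comp_measurable measurable_fst
  | node l r hl hr =>
    cases m with
    | zero => exact stronglyMeasurable_const
    | succ m =>
      exact StronglyMeasurable.ite (measurable_snd (measurableSet_coin _))
        ((hl m b).add (hr m _)) ((hr m b).add (hl m _))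

theorem stronglyMeasurable_walk (T : DyadicTree X) (m : ℕ) (b t : ℤ) {S : Type*}
    [MeasurableSpace S] {c : S → ℤ → ULift.{v} Bool} (hc : Measurable c) :
    StronglyMeasurable (fun ω ↦ T.walk m b (c ω) t) :=
  (T.stronglyMeasurable_walk_uncurry m b).comp_measurable (measurable_const.prodMk hc)

theorem exists_norm_walk_le (T : DyadicTree X) (m : ℕ) :
    ∃ B : ℝ, ∀ b (c : ℤ → ULift.{v} Bool) t, ‖T.walk m b c t‖ ≤ B := by
  induction T generalizing m with
  | leaf x =>
    refine ⟨2 ^ m * ‖x‖, fun b c t ↦ ?_⟩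
    rw [walk, norm_smul]
    gcongr
    have h1 : max 0 (min (t - b) (2 ^ m)) ≤ (2 : ℤ) ^ m :=
      max_le (by positivity) (min_le_right _ _)
    have h0 : 0 ≤ max 0 (min (t - b) (2 ^ m)) := le_max_left _ _
    rw [Real.norm_of_nonneg (by exact_mod_cast h0)]
    exact_mod_cast h1
  | node l r hl hr =>
    cases m with
    | zero => exact ⟨0, fun b c t ↦ by simp [walk]⟩
    | succ m =>
      obtain ⟨B, hB⟩ := hl m
      obtain ⟨C, hC⟩ := hr m
      refine ⟨B + C, fun b c t ↦ ?_⟩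
      rw [walk]
      split_ifs
      · exact (norm_add_le _ _).trans (add_le_add (hB _ _ _) (hC _ _ _))
      · rw [add_comm B C]
        exact (norm_add_le _ _).trans (add_le_add (hC _ _ _) (hB _ _ _))

theorem integrable_walk (T : DyadicTree X) (m : ℕ) (b t : ℤ) {S : Type*}
    [MeasurableSpace S] {c : S → ℤ → ULift.{v} Bool} (hc : Measurable c) (P : Measure S)
    [IsFiniteMeasure P] : Integrable (fun ω ↦ T.walk m b (c ω) t) P := by
  obtain ⟨B, hB⟩ := exists_norm_walk_le.{v} T m
  exact Integrable.of_bound (T.stronglyMeasurable_walk m b t hc).aestronglyMeasurable B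
    (.of_forall fun ω ↦ hB _ _ _)

end Measurability

/-- The law of a family of independent fair coins. -/
noncomputable abbrev coinMeasure (ι : Type*) : Measure (ι → ULift.{v} Bool) :=
  Measure.infinitePi fun _ ↦ fairCoin

/-- On average, the walk moves at the constant speed `T.mean` during its block. -/
theorem integral_walk {X : Type*} [NormedAddCommGroup X] [NormedSpace ℝ X] [CompleteSpace X]
    (T : DyadicTree X) {ι : Type*} [DecidableEq ι] {j : ℤ → ι} (hj : Function.Injective j)
    {m : ℕ} (hm : T.depth ≤ m) (b t : ℤ) :
    ∫ ω, T.walk m b (fun u ↦ ω (j u)) t ∂coinMeasure.{v} ι =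
      ((max 0 (min (t - b) (2 ^ m)) : ℤ) : ℝ) • T.mean := by
  induction T generalizing m b with
  | leaf x => simp [walk, mean]
  | node l r hl hr =>
    cases m with
    | zero => simp [depth] at hm
    | succ m =>
      rw [depth] at hm
      have h2 : (0 : ℤ) < 2 ^ m := by positivity
      have hc : Measurable (fun (ω : ι → ULift.{v} Bool) u ↦ ω (j u)) := by fun_prop
      have hint := fun (T : DyadicTree X) b ↦ T.integrable_walk m b t hc (coinMeasure.{v} ι)
      simp only [walk]
      rw [integral_ite_coin
          (H₁ := fun ω ↦ l.walk m b (fun u ↦ ω (j u)) t + r.walk m (b + 2 ^ m) (fun u ↦ ω (j u)) t)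
          (H₀ := fun ω ↦ r.walk m b (fun u ↦ ω (j u)) t + l.walk m (b + 2 ^ m) (fun u ↦ ω (j u)) t)
          ((hint l _).add (hint r _)) ((hint r _).add (hint l _)),
        integral_add (hint l _) (hint r _), integral_add (hint r _) (hint l _),
        hl (by omega), hl (by omega), hr (by omega), hr (by omega), mean]
      · have e : (max 0 (min (t - b) (2 ^ (m + 1))) : ℤ) =
            max 0 (min (t - b) (2 ^ m)) + max 0 (min (t - (b + 2 ^ m)) (2 ^ m)) := by
          rw [pow_succ]
          omega
        rw [e, Int.cast_add]
        module
      · intro ω e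
        rw [l.walk_update hj (by omega), r.walk_update hj (by omega)]
      · intro ω e
        rw [l.walk_update hj (by omega), r.walk_update hj (by omega)]

/-- The steps of the walk run through the leaves: whatever the coins are, the `p`-th powers of their
norms add up to `2 ^ m` times the energy. -/
theorem tsum_walk_step_le {X : Type*} [NormedAddCommGroup X] [NormedSpace ℝ X]
    (T : DyadicTree X) {p : ℝ} (hp : 0 < p) {m : ℕ} (hm : T.depth ≤ m) (b : ℤ)
    (c : ℤ → ULift.{v} Bool) :
    ∑' t : ℤ, ‖T.walk m b c t - T.walk m b c (t - 1)‖ₑ ^ p ≤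
      ENNReal.ofReal (2 ^ m * T.energy p) := by
  induction T generalizing m b with
  | leaf x =>
    have h2 : (0 : ℤ) < 2 ^ m := by positivity
    have hstep : ∀ t : ℤ, ‖(leaf x).walk m b c t - (leaf x).walk m b c (t - 1)‖ₑ ^ p =
        if t ∈ Finset.Ioc b (b + 2 ^ m) then ‖x‖ₑ ^ p else 0 := by
      intro t
      rw [walk, walk, ← sub_smul, ← Int.cast_sub]
      split_ifs with h
      · rw [Finset.mem_Ioc] at h
        have : max 0 (min (t - b) (2 ^ m)) - max 0 (min (t - 1 - b) (2 ^ m)) = 1 := by omega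
        rw [this, Int.cast_one, one_smul]
      · rw [Finset.mem_Ioc] at h
        have : max 0 (min (t - b) (2 ^ m)) - max 0 (min (t - 1 - b) (2 ^ m)) = 0 := by omega
        rw [this, Int.cast_zero, zero_smul, enorm_zero, ENNReal.zero_rpow_of_pos hp]
    simp_rw [hstep]
    rw [tsum_eq_sum (s := Finset.Ioc b (b + 2 ^ m)) (fun t ht ↦ if_neg ht),
      Finset.sum_congr rfl (fun t ht ↦ if_pos ht), Finset.sum_const, Int.card_Ioc,
      add_sub_cancel_left, energy, nsmul_eq_mul, ENNReal.ofReal_mul (by positivity),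
      ← ENNReal.ofReal_rpow_of_nonneg (norm_nonneg _) hp.le, ofReal_norm]
    refine le_of_eq ?_
    congr 1
    rw [show ((2 : ℤ) ^ m).toNat = 2 ^ m by
      rw [show (2 : ℤ) ^ m = ((2 ^ m : ℕ) : ℤ) by push_cast; rfl, Int.toNat_natCast]]
    rw [ENNReal.ofReal_pow (by norm_num)]
    simp
  | node l r hl hr =>
    cases m with
    | zero => simp [depth] at hm
    | succ m =>
      have h2 : (0 : ℤ) < 2 ^ m := by positivity
      have hcase : ∀ T T' : DyadicTree X, T.depth ≤ m →
          (∀ b, ∑' t : ℤ, ‖T.walk m b c t - T.walk m b c (t - 1)‖ₑ ^ p ≤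
            ENNReal.ofReal (2 ^ m * T.energy p)) →
          (∀ b, ∑' t : ℤ, ‖T'.walk m b c t - T'.walk m b c (t - 1)‖ₑ ^ p ≤
            ENNReal.ofReal (2 ^ m * T'.energy p)) →
          ∑' t : ℤ, ‖(T.walk m b c t + T'.walk m (b + 2 ^ m) c t) -
            (T.walk m b c (t - 1) + T'.walk m (b + 2 ^ m) c (t - 1))‖ₑ ^ p ≤
            ENNReal.ofReal (2 ^ (m + 1) * ((T.energy p + T'.energy p) / 2)) := by
        intro T T' hd hT hT'
        have e : (2 : ℝ) ^ (m + 1) * ((T.energy p + T'.energy p) / 2) =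
            2 ^ m * T.energy p + 2 ^ m * T'.energy p := by ring
        have h1 := T.energy_nonneg p
        have h1' := T'.energy_nonneg p
        rw [e, ENNReal.ofReal_add (by positivity) (by positivity)]
        refine le_trans ?_ (add_le_add (hT b) (hT' (b + 2 ^ m)))
        rw [← ENNReal.tsum_add]
        refine ENNReal.tsum_le_tsum fun t ↦ ?_
        by_cases ht : t ≤ b + 2 ^ m
        · rw [T'.walk_of_le c ht, T'.walk_of_le c (show t - 1 ≤ b + 2 ^ m by omega), add_zero,
            add_zero]
          exact le_self_add
        · rw [T.walk_of_ge c hd (show b + 2 ^ m ≤ t by omega),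
            T.walk_of_ge c hd (show b + 2 ^ m ≤ t - 1 by omega), add_sub_add_left_eq_sub]
          exact le_add_self
      rw [depth] at hm
      have hml : l.depth ≤ m := by omega
      have hmr : r.depth ≤ m := by omega
      simp only [walk, energy]
      split_ifs
      · exact hcase l r hml (hl hml) (hr hmr)
      · rw [add_comm (l.energy p)]
        exact hcase r l hmr (hr hmr) (hl hml)

end DyadicTree

/-! ### The dyadic martingale inequality -/

namespace DyadicTree

section Branch

variable {X : Type*} [NormedAddCommGroup X] [NormedSpace ℝ X] {p : ℝ} {l r : DyadicTree X} {m k : ℕ}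
  {b t : ℤ}

/-- The expected `p`-th power of the distance at time `t` between the walk and its copy branched off
at time `t - 2 ^ k`. -/
noncomputable def branchTerm (p : ℝ) (T : DyadicTree X) (m : ℕ) (b : ℤ) (k : ℕ) (t : ℤ) : ℝ≥0∞ :=
  ∫⁻ ω, ‖T.walk m b (fun u ↦ ω (Sum.inl u)) t - T.walk m b (splice (t - 2 ^ k) ω) t‖ₑ ^ p
    ∂coinMeasure.{v} (ℤ ⊕ ℤ)

theorem splice_update_inl (s n : ℤ) (ω : ℤ ⊕ ℤ → ULift.{v} Bool) (e : ULift.{v} Bool) {u : ℤ}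
    (hu : u ≠ n) : splice s (Function.update ω (Sum.inl n) e) u = splice s ω u := by
  have h : (Sum.inl u : ℤ ⊕ ℤ) ≠ Sum.inl n := by simpa using hu
  simp [splice, Function.update_of_ne h]

theorem measurable_branch (T : DyadicTree X) (m : ℕ) (b t s : ℤ) :
    Measurable (fun ω : ℤ ⊕ ℤ → ULift.{v} Bool ↦
      ‖T.walk m b (fun u ↦ ω (Sum.inl u)) t - T.walk m b (splice s ω) t‖ₑ ^ p) :=
  ((T.stronglyMeasurable_walk m b t (by fun_prop)).sub
    (T.stronglyMeasurable_walk m b t (measurable_splice s))).enorm.pow_const p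

theorem branch_update (T : DyadicTree X) {a n : ℤ} (hn : n ≤ a - 2 ^ m + 1) (s : ℤ)
    (ω : ℤ ⊕ ℤ → ULift.{v} Bool) (e : ULift.{v} Bool) :
    ‖T.walk m a (fun u ↦ Function.update ω (Sum.inl n) e (Sum.inl u)) t -
      T.walk m a (splice s (Function.update ω (Sum.inl n) e)) t‖ₑ ^ p =
    ‖T.walk m a (fun u ↦ ω (Sum.inl u)) t - T.walk m a (splice s ω) t‖ₑ ^ p := by
  rw [T.walk_update Sum.inl_injective hn, T.walk_congr (c := splice s (Function.update ω _ e))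
    fun u hu _ ↦ splice_update_inl s n ω e (by omega)]

/-- During the first half of a block, a copy branched off at scale at most `m` shares the coin of
the root, so that it traverses the same subtree. -/
theorem branchTerm_node_of_le (hk : k ≤ m) (hb : b < t) (ht : t ≤ b + 2 ^ m) :
    (node l r).branchTerm.{v} p (m + 1) b k t =
      2⁻¹ * (l.branchTerm.{v} p m b k t + r.branchTerm.{v} p m b k t) := by
  have hkm : (2 : ℤ) ^ k ≤ 2 ^ m := pow_le_pow_right₀ (by norm_num) hk
  simp only [branchTerm]
  rw [← lintegral_ite_coin (i := (Sum.inl (b - 2 ^ m + 1) : ℤ ⊕ ℤ)) (l.measurable_branch _ _ _ _)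
    (r.measurable_branch _ _ _ _) (l.branch_update (by omega) _) (r.branch_update (by omega) _)]
  refine lintegral_congr fun ω ↦ ?_
  have hs : splice (t - 2 ^ k) ω (b - 2 ^ m + 1) = ω (Sum.inl (b - 2 ^ m + 1)) :=
    if_pos (by omega)
  rw [walk, walk, hs]
  split_ifs
  · rw [r.walk_of_le _ ht, r.walk_of_le _ ht, add_zero, add_zero]
  · rw [l.walk_of_le _ ht, l.walk_of_le _ ht, add_zero, add_zero]

/-- During the second half of a block, a copy branched off at scale at most `m` shares the coin of
the root and hence the displacement made in the first half. -/
theorem branchTerm_node_of_gt (hl : l.depth ≤ m) (hr : r.depth ≤ m) (hk : k ≤ m)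
    (hb : b + 2 ^ m < t) :
    (node l r).branchTerm.{v} p (m + 1) b k t =
      2⁻¹ * (r.branchTerm.{v} p m (b + 2 ^ m) k t + l.branchTerm.{v} p m (b + 2 ^ m) k t) := by
  have hkm : (2 : ℤ) ^ k ≤ 2 ^ m := pow_le_pow_right₀ (by norm_num) hk
  have h2 : (0 : ℤ) < 2 ^ m := by positivity
  simp only [branchTerm]
  rw [← lintegral_ite_coin (i := (Sum.inl (b - 2 ^ m + 1) : ℤ ⊕ ℤ)) (r.measurable_branch _ _ _ _)
    (l.measurable_branch _ _ _ _) (r.branch_update (by omega) _) (l.branch_update (by omega) _)]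
  refine lintegral_congr fun ω ↦ ?_
  have hs : splice (t - 2 ^ k) ω (b - 2 ^ m + 1) = ω (Sum.inl (b - 2 ^ m + 1)) :=
    if_pos (by omega)
  rw [walk, walk, hs]
  split_ifs
  · rw [l.walk_of_ge _ hl hb.le, l.walk_of_ge _ hl hb.le, add_sub_add_left_eq_sub]
  · rw [r.walk_of_ge _ hr hb.le, r.walk_of_ge _ hr hb.le, add_sub_add_left_eq_sub]

/-- Two independent walks through different subtrees are, on average, at least as far apart as
their means (Jensen's inequality). -/
theorem enorm_smul_sub_mean_le [CompleteSpace X] (hp : 1 ≤ p) (hl : l.depth ≤ m) (hr : r.depth ≤ m)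
    (hb : b < t) (ht : t ≤ b + 2 ^ m) :
    ‖((t - b : ℤ) : ℝ) • (l.mean - r.mean)‖ₑ ^ p ≤
      ∫⁻ ω, ‖l.walk m b (fun u ↦ ω (Sum.inl u)) t - r.walk m b (fun u ↦ ω (Sum.inr u)) t‖ₑ ^ p
        ∂coinMeasure.{v} (ℤ ⊕ ℤ) := by
  have h1 := l.integrable_walk m b t (c := fun (ω : ℤ ⊕ ℤ → ULift.{v} Bool) u ↦ ω (Sum.inl u))
    (by fun_prop) (coinMeasure.{v} (ℤ ⊕ ℤ))
  have h2 := r.integrable_walk m b t (c := fun (ω : ℤ ⊕ ℤ → ULift.{v} Bool) u ↦ ω (Sum.inr u))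
    (by fun_prop) (coinMeasure.{v} (ℤ ⊕ ℤ))
  have hi := integral_sub h1 h2
  rw [l.integral_walk Sum.inl_injective hl, r.integral_walk Sum.inr_injective hr, ← smul_sub,
    min_eq_left (by omega), max_eq_right (by omega)] at hi
  rw [← hi]
  have hm := (h1.sub h2).aestronglyMeasurable
  have hn := eLpNorm_le_eLpNorm_of_exponent_le (p := 1) (q := ENNReal.ofReal p)
    (by simpa using hp) hm
  rw [eLpNorm_one_eq_lintegral_enorm,
    eLpNorm_eq_lintegral_rpow_enorm_toReal (by simp; linarith) ENNReal.ofReal_ne_top,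
    ENNReal.toReal_ofReal (by linarith)] at hn
  calc _ ≤ _ := ENNReal.rpow_le_rpow ((enorm_integral_le_lintegral_enorm _).trans hn) (by linarith)
    _ = _ := by rw [← ENNReal.rpow_mul, one_div_mul_cancel (by linarith), ENNReal.rpow_one]; rfl

/-- During the first half of a block, a copy branched off at scale `m + 1` uses an independent coin
for the root: with probability `1 / 2` it traverses the other subtree. -/
theorem le_branchTerm_node_top [CompleteSpace X] (hp : 1 ≤ p) (hl : l.depth ≤ m)
    (hr : r.depth ≤ m) (hb : b < t) (ht : t ≤ b + 2 ^ m) :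
    2⁻¹ * ‖((t - b : ℤ) : ℝ) • (l.mean - r.mean)‖ₑ ^ p ≤
      (node l r).branchTerm.{v} p (m + 1) b (m + 1) t := by
  have h2 : (0 : ℤ) < 2 ^ m := by positivity
  have hpow : (2 : ℤ) ^ (m + 1) = 2 ^ m + 2 ^ m := by ring
  set n := b - 2 ^ m + 1 with hn
  -- the distance between independent walks through `T` and `T'`
  let H : DyadicTree X → DyadicTree X → (ℤ ⊕ ℤ → ULift.{v} Bool) → ℝ≥0∞ := fun T T' ω ↦
    ‖T.walk m b (fun u ↦ ω (Sum.inl u)) t - T'.walk m b (fun u ↦ ω (Sum.inr u)) t‖ₑ ^ p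
  have hH : ∀ T T', Measurable (H T T') := fun T T' ↦
    ((T.stronglyMeasurable_walk m b t (by fun_prop)).sub
      (T'.stronglyMeasurable_walk m b t (by fun_prop))).enorm.pow_const p
  have hinl : ∀ T T' ω e, H T T' (Function.update ω (Sum.inl n) e) = H T T' ω := by
    intro T T' ω e
    simp only [H]
    rw [T.walk_update Sum.inl_injective (by omega)]
    simp
  have hinr : ∀ T T' ω e, H T T' (Function.update ω (Sum.inr n) e) = H T T' ω := by
    intro T T' ω e
    simp only [H]
    rw [T'.walk_update Sum.inr_injective (by omega)]
    simp
  have hcoin : Measurable fun ω : ℤ ⊕ ℤ → ULift.{v} Bool ↦ (0 : ℝ≥0∞) := measurable_const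
  let H₁ : (ℤ ⊕ ℤ → ULift.{v} Bool) → ℝ≥0∞ := fun ω ↦
    if (ω (Sum.inr n)).down = true then 0 else H l r ω
  let H₀ : (ℤ ⊕ ℤ → ULift.{v} Bool) → ℝ≥0∞ := fun ω ↦
    if (ω (Sum.inr n)).down = true then H r l ω else 0
  have m₁ : Measurable H₁ := Measurable.ite (measurableSet_coin _) measurable_const (hH l r)
  have m₀ : Measurable H₀ := Measurable.ite (measurableSet_coin _) (hH r l) measurable_const
  have i₁ : ∫⁻ ω, H₁ ω ∂coinMeasure.{v} (ℤ ⊕ ℤ) = 2⁻¹ * ∫⁻ ω, H l r ω ∂coinMeasure.{v} (ℤ ⊕ ℤ) := by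
    have := lintegral_ite_coin (i := (Sum.inr n : ℤ ⊕ ℤ)) hcoin (hH l r) (fun _ _ ↦ rfl) (hinr l r)
    rwa [lintegral_zero, zero_add] at this
  have i₀ : ∫⁻ ω, H₀ ω ∂coinMeasure.{v} (ℤ ⊕ ℤ) = 2⁻¹ * ∫⁻ ω, H r l ω ∂coinMeasure.{v} (ℤ ⊕ ℤ) := by
    have := lintegral_ite_coin (i := (Sum.inr n : ℤ ⊕ ℤ)) (hH r l) hcoin (hinr r l) (fun _ _ ↦ rfl)
    rwa [lintegral_zero, add_zero] at this
  have key : ∫⁻ ω, (if (ω (Sum.inl n)).down = true then H₁ ω else H₀ ω) ∂coinMeasure.{v} (ℤ ⊕ ℤ) ≤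
      (node l r).branchTerm.{v} p (m + 1) b (m + 1) t := by
    refine lintegral_mono fun ω ↦ ?_
    have hs : splice (t - 2 ^ (m + 1)) ω n = ω (Sum.inr n) := if_neg (by omega)
    have hc : ∀ T : DyadicTree X, T.walk m b (splice (t - 2 ^ (m + 1)) ω) t =
        T.walk m b (fun u ↦ ω (Sum.inr u)) t := fun T ↦ T.walk_congr fun u hu _ ↦
      if_neg (by omega)
    have hz : ∀ (T : DyadicTree X) (c : ℤ → ULift.{v} Bool), T.walk m (b + 2 ^ m) c t = 0 :=
      fun T c ↦ T.walk_of_le c ht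
    simp only [H₁, H₀]
    rw [walk, walk, ← hn, hs]
    simp only [hz, hc, add_zero]
    split_ifs <;> first | exact le_rfl | exact bot_le
  rw [lintegral_ite_coin m₁ m₀, i₁, i₀] at key
  · refine le_trans ?_ key
    have e1 := enorm_smul_sub_mean_le.{v} hp hl hr hb ht
    have e0 := enorm_smul_sub_mean_le.{v} hp hr hl hb ht
    rw [← neg_sub l.mean, smul_neg, enorm_neg] at e0
    calc 2⁻¹ * ‖((t - b : ℤ) : ℝ) • (l.mean - r.mean)‖ₑ ^ p
        = 2⁻¹ * (2⁻¹ * ‖((t - b : ℤ) : ℝ) • (l.mean - r.mean)‖ₑ ^ p +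
          2⁻¹ * ‖((t - b : ℤ) : ℝ) • (l.mean - r.mean)‖ₑ ^ p) := by
          rw [← add_mul, ENNReal.inv_two_add_inv_two, one_mul]
      _ ≤ _ := by gcongr
  · intro ω e
    simp only [H₁, hinl]
    simp
  · intro ω e
    simp only [H₀, hinl]
    simp

end Branch

theorem rpow_div_le_sum_rpow {p : ℝ} (hp : 0 ≤ p) (n : ℕ) :
    (n : ℝ) ^ (p + 1) / (p + 1) ≤ ∑ s ∈ Finset.range n, ((s : ℝ) + 1) ^ p := by
  induction n with
  | zero => simp [Real.zero_rpow (show p + 1 ≠ 0 by linarith)]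
  | succ n ih =>
    rw [Finset.sum_range_succ]
    have hn : (0 : ℝ) < n + 1 := by positivity
    have hb := one_add_mul_self_le_rpow_one_add (s := -(1 / ((n : ℝ) + 1))) (p := p + 1)
      (by rw [neg_le_neg_iff, div_le_one hn]; linarith [(Nat.cast_nonneg n : (0 : ℝ) ≤ n)])
      (by linarith)
    have e : (1 : ℝ) + -(1 / ((n : ℝ) + 1)) = n / (n + 1) := by field_simp; ring
    rw [e, Real.div_rpow (by positivity) hn.le, le_div_iff₀ (by positivity)] at hb
    have e2 : ((n : ℝ) + 1) ^ (p + 1) = (n + 1) ^ p * (n + 1) := Real.rpow_add_one hn.ne' p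
    have hb' : ((n : ℝ) + 1) ^ (p + 1) - (p + 1) * (n + 1) ^ p ≤ (n : ℝ) ^ (p + 1) := by
      refine le_trans (le_of_eq ?_) hb
      rw [e2]
      field_simp
      ring
    have hp1 : 0 < p + 1 := by linarith
    push_cast
    calc ((n : ℝ) + 1) ^ (p + 1) / (p + 1)
        ≤ ((n : ℝ) ^ (p + 1) + (p + 1) * (n + 1) ^ p) / (p + 1) := by gcongr; linarith
      _ = (n : ℝ) ^ (p + 1) / (p + 1) + (n + 1) ^ p := by field_simp
      _ ≤ _ := by gcongr

/-- The contribution to the branching sum of a block of the walk, summed over the scales up to the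
level of the block, controls the deviation of the tree. -/
theorem ofReal_deviation_le_sum_branchTerm {X : Type*} [NormedAddCommGroup X] [NormedSpace ℝ X]
    [CompleteSpace X] {p : ℝ} (hp : 1 ≤ p) (T : DyadicTree X) {m : ℕ} (hm : T.depth ≤ m) (b : ℤ) :
    ENNReal.ofReal (2 ^ m * (T.deviation p / (4 * (p + 1)))) ≤
      ∑ k ∈ Finset.range m, (∑ t ∈ Finset.Ioc b (b + 2 ^ m), T.branchTerm.{v} p m b (k + 1) t) /
        2 ^ (((k + 1 : ℕ) : ℝ) * p) := by
  induction T generalizing m b with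
  | leaf x => simp [deviation]
  | node l r hl hr =>
    cases m with
    | zero => simp [depth] at hm
    | succ m =>
      rw [depth] at hm
      have hml : l.depth ≤ m := by omega
      have hmr : r.depth ≤ m := by omega
      have h2 : (0 : ℤ) < 2 ^ m := by positivity
      have hpow : b + (2 : ℤ) ^ (m + 1) = b + 2 ^ m + 2 ^ m := by ring
      set D : DyadicTree X → ℤ → ℝ≥0∞ := fun T b ↦ ∑ k ∈ Finset.range m,
        (∑ t ∈ Finset.Ioc b (b + 2 ^ m), T.branchTerm.{v} p m b (k + 1) t) /
          2 ^ (((k + 1 : ℕ) : ℝ) * p) with hD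
      have hlow : ∑ k ∈ Finset.range m, (∑ t ∈ Finset.Ioc b (b + 2 ^ (m + 1)),
          (node l r).branchTerm.{v} p (m + 1) b (k + 1) t) / 2 ^ (((k + 1 : ℕ) : ℝ) * p) =
          2⁻¹ * (D l b + D r b) + 2⁻¹ * (D r (b + 2 ^ m) + D l (b + 2 ^ m)) := by
        simp only [hD]
        rw [← Finset.sum_add_distrib, ← Finset.sum_add_distrib, Finset.mul_sum, Finset.mul_sum,
          ← Finset.sum_add_distrib]
        refine Finset.sum_congr rfl fun k hk ↦ ?_
        have hk' : k + 1 ≤ m := by simpa using hk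
        have hsplit : Finset.Ioc b (b + 2 ^ (m + 1)) =
            Finset.Ioc b (b + 2 ^ m) ∪ Finset.Ioc (b + 2 ^ m) (b + 2 ^ m + 2 ^ m) := by
          rw [hpow, Finset.Ioc_union_Ioc_eq_Ioc (by omega) (by omega)]
        rw [hsplit, Finset.sum_union (Finset.Ioc_disjoint_Ioc_of_le le_rfl),
          Finset.sum_congr rfl fun t ht ↦ branchTerm_node_of_le (l := l) (r := r) (p := p) hk'
            (Finset.mem_Ioc.1 ht).1 (Finset.mem_Ioc.1 ht).2,
          Finset.sum_congr rfl fun t ht ↦ branchTerm_node_of_gt (p := p) hml hmr hk'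
            (Finset.mem_Ioc.1 ht).1,
          ← Finset.mul_sum, ← Finset.mul_sum, Finset.sum_add_distrib, Finset.sum_add_distrib]
        simp only [div_eq_mul_inv]
        ring
      have hS := rpow_div_le_sum_rpow (show 0 ≤ p by linarith) (2 ^ m)
      have htop : ENNReal.ofReal (2 ^ (m + 1) *
          (‖(2⁻¹ : ℝ) • (l.mean - r.mean)‖ ^ p / (4 * (p + 1)))) ≤
          (∑ t ∈ Finset.Ioc b (b + 2 ^ (m + 1)),
            (node l r).branchTerm.{v} p (m + 1) b (m + 1) t) / 2 ^ (((m + 1 : ℕ) : ℝ) * p) := by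
        set d := l.mean - r.mean with hd
        have hsum : ENNReal.ofReal (2⁻¹ * (∑ s ∈ Finset.range (2 ^ m), ((s : ℝ) + 1) ^ p) *
            ‖d‖ ^ p) ≤ ∑ t ∈ Finset.Ioc b (b + 2 ^ (m + 1)),
            (node l r).branchTerm.{v} p (m + 1) b (m + 1) t := by
          have hinj : Set.InjOn (fun s : ℕ ↦ b + 1 + (s : ℤ)) (Finset.range (2 ^ m) : Set ℕ) :=
            fun x _ y _ h ↦ by simpa using h
          have hsub : (Finset.range (2 ^ m)).image (fun s : ℕ ↦ b + 1 + (s : ℤ)) ⊆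
              Finset.Ioc b (b + 2 ^ (m + 1)) := by
            intro t ht
            obtain ⟨s, hs, rfl⟩ := Finset.mem_image.1 ht
            have hs' : (s : ℤ) < 2 ^ m := by exact_mod_cast Finset.mem_range.1 hs
            rw [Finset.mem_Ioc, hpow]
            omega
          refine le_trans ?_ (Finset.sum_le_sum_of_subset hsub)
          rw [Finset.sum_image hinj, Finset.mul_sum, Finset.sum_mul,
            ENNReal.ofReal_sum_of_nonneg fun s _ ↦ by positivity]
          refine Finset.sum_le_sum fun s hs ↦ ?_
          have hs' : (s : ℤ) < 2 ^ m := by exact_mod_cast Finset.mem_range.1 hs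
          refine le_trans (le_of_eq ?_) (le_branchTerm_node_top (l := l) (r := r) hp hml hmr
            (by omega) (by omega))
          have e : ((b + 1 + (s : ℤ) - b : ℤ) : ℝ) = (s : ℝ) + 1 := by push_cast; ring
          rw [e, ← ofReal_norm, norm_smul, Real.norm_of_nonneg (by positivity),
            ENNReal.ofReal_rpow_of_nonneg (by positivity) (by linarith),
            Real.mul_rpow (by positivity) (norm_nonneg _), mul_assoc,
            ENNReal.ofReal_mul (by norm_num), ENNReal.ofReal_inv_of_pos (by norm_num)]
          simp [hd]
        rw [ENNReal.le_div_iff_mul_le (.inl (by simp)) (.inl (by simp))]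
        refine le_trans ?_ hsum
        have e : (2 : ℝ≥0∞) ^ (((m + 1 : ℕ) : ℝ) * p) =
            ENNReal.ofReal ((2 : ℝ) ^ (((m + 1 : ℕ) : ℝ) * p)) := by
          rw [← ENNReal.ofReal_rpow_of_pos (by norm_num)]
          simp
        rw [e, ← ENNReal.ofReal_mul (by positivity)]
        refine ENNReal.ofReal_le_ofReal ?_
        rw [norm_smul, Real.mul_rpow (by positivity) (norm_nonneg _)]
        have e1 : (2 : ℝ) ^ (((m + 1 : ℕ) : ℝ) * p) = ((2 : ℝ) ^ m) ^ p * 2 ^ p := by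
          rw [Real.rpow_mul (by norm_num), Real.rpow_natCast, pow_succ,
            Real.mul_rpow (by positivity) (by norm_num)]
        have e2 : ‖(2⁻¹ : ℝ)‖ ^ p = (2 ^ p)⁻¹ := by
          rw [Real.norm_of_nonneg (by norm_num), Real.inv_rpow (by norm_num)]
        push_cast at hS
        rw [Real.rpow_add_one (by positivity)] at hS
        have h2p : (0 : ℝ) < 2 ^ p := by positivity
        have hp1 : 0 < p + 1 := by linarith
        calc _ = 2⁻¹ * ((((2 : ℝ) ^ m) ^ p * 2 ^ m) / (p + 1)) * ‖d‖ ^ p := by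
              rw [e1, e2, pow_succ]
              field_simp
              ring
          _ ≤ _ := by gcongr
      have hdl := l.deviation_nonneg p
      have hdr := r.deviation_nonneg p
      have hp1 : 0 < p + 1 := by linarith
      rw [Finset.sum_range_succ, hlow]
      refine le_trans ?_ (add_le_add (add_le_add
        (mul_le_mul_right (add_le_add (hl hml b) (hr hmr b)) _)
        (mul_le_mul_right (add_le_add (hr hmr (b + 2 ^ m)) (hl hml (b + 2 ^ m))) _)) htop)
      refine le_of_eq ?_
      have e : (2⁻¹ : ℝ≥0∞) = ENNReal.ofReal 2⁻¹ := by
        rw [ENNReal.ofReal_inv_of_pos (by norm_num)]; simp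
      rw [e, ← ENNReal.ofReal_add (by positivity) (by positivity),
        ← ENNReal.ofReal_add (by positivity) (by positivity),
        ← ENNReal.ofReal_mul (by positivity), ← ENNReal.ofReal_mul (by positivity),
        ← ENNReal.ofReal_add (by positivity) (by positivity),
        ← ENNReal.ofReal_add (by positivity) (by positivity), deviation]
      congr 1
      field_simp
      ring

/-- Markov convexity, applied to the random walk of a tree, gives the martingale cotype inequality
for dyadic martingales. -/
theorem deviation_le_of_isMarkovConvexWith {X : Type u} [NormedAddCommGroup X] [NormedSpace ℝ X]
    [CompleteSpace X] {p : ℝ} (hp : 1 ≤ p) {C : ℝ≥0} (hC : IsMarkovConvexWith.{u, v} X p C)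
    (T : DyadicTree X) : T.deviation p / (4 * (p + 1)) ≤ (C : ℝ) ^ p * T.energy p := by
  set m := T.depth with hm
  have hp0 : 0 < p := by linarith
  let c₀ : (ℤ ⊕ ℤ → ULift.{v} Bool) → ℤ → ULift.{v} Bool := fun ω u ↦ ω (Sum.inl u)
  let f : ℤ × (ℤ → ULift.{v} Bool) → X := fun q ↦ T.walk m 0 q.2 q.1
  have hf : ∀ (c : ℤ → ULift.{v} Bool) t, f (historyState c t) = T.walk m 0 c t := fun c t ↦
    T.walk_congr fun u _ hu ↦ if_pos hu
  have hM := hC (ℤ × (ℤ → ULift.{v} Bool)) (ℤ ⊕ ℤ → ULift.{v} Bool) (coinMeasure.{v} (ℤ ⊕ ℤ))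
    (fun _ ↦ historyKernel fairCoin) (fun t ω ↦ historyState (c₀ ω) t)
    (fun k t ω ↦ historyState (splice k ω) t) (isMarkovChain_history fairCoin)
    (isBranchedCopy_history fairCoin) f
    (fun t ↦ (T.stronglyMeasurable_walk_uncurry m 0).aestronglyMeasurable)
  simp only [hf, edist_eq_enorm_sub] at hM
  have hright : ∑' t : ℤ, ∫⁻ ω, ‖T.walk m 0 (c₀ ω) t - T.walk m 0 (c₀ ω) (t - 1)‖ₑ ^ p
      ∂coinMeasure.{v} (ℤ ⊕ ℤ) ≤ ENNReal.ofReal (2 ^ m * T.energy p) := by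
    rw [← lintegral_tsum]
    · calc _ ≤ ∫⁻ ω, ENNReal.ofReal (2 ^ m * T.energy p) ∂coinMeasure.{v} (ℤ ⊕ ℤ) :=
            lintegral_mono fun ω ↦ T.tsum_walk_step_le hp0 hm.ge 0 (c₀ ω)
        _ = _ := by simp
    · intro t
      exact (((T.stronglyMeasurable_walk m 0 t (by fun_prop)).sub
        (T.stronglyMeasurable_walk m 0 (t - 1) (by fun_prop))).enorm.pow_const p).aemeasurable
  have hleft : ENNReal.ofReal (2 ^ m * (T.deviation p / (4 * (p + 1)))) ≤
      ∑' k : ℕ, ∑' t : ℤ, T.branchTerm.{v} p m 0 k t / 2 ^ ((k : ℝ) * p) := by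
    refine (T.ofReal_deviation_le_sum_branchTerm.{v} hp hm.ge 0).trans ?_
    calc _ ≤ ∑ k ∈ Finset.range m, ∑' t : ℤ,
          T.branchTerm.{v} p m 0 (k + 1) t / 2 ^ (((k + 1 : ℕ) : ℝ) * p) := by
          refine Finset.sum_le_sum fun k _ ↦ ?_
          simp only [div_eq_mul_inv]
          rw [ENNReal.tsum_mul_right]
          gcongr
          exact ENNReal.sum_le_tsum _
      _ ≤ ∑' k : ℕ, ∑' t : ℤ, T.branchTerm.{v} p m 0 (k + 1) t / 2 ^ (((k + 1 : ℕ) : ℝ) * p) :=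
          ENNReal.sum_le_tsum _
      _ ≤ _ := ENNReal.tsum_comp_le_tsum_of_injective (add_left_injective 1)
          (fun k : ℕ ↦ ∑' t : ℤ, T.branchTerm.{v} p m 0 k t / 2 ^ ((k : ℝ) * p))
  have h := hleft.trans (hM.trans (mul_le_mul_right hright _))
  have he := T.energy_nonneg p
  have e : (C : ℝ≥0∞) ^ p = ENNReal.ofReal ((C : ℝ) ^ p) := by
    rw [← ENNReal.ofReal_rpow_of_nonneg C.coe_nonneg hp0.le, ENNReal.ofReal_coe_nnreal]
  rw [e, ← ENNReal.ofReal_mul (by positivity), ENNReal.ofReal_le_ofReal_iff (by positivity)] at h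
  have h2 : (0 : ℝ) < 2 ^ m := by positivity
  rw [mul_left_comm] at h
  exact le_of_mul_le_mul_left h h2

end DyadicTree

/-! ### Renorming with dyadic trees -/

/-- A midpoint convex function on `[0, 1]` that is bounded above lies below its chord. -/
theorem le_chord_of_midpoint_le {h : ℝ → ℝ} {B : ℝ} (hB : ∀ t ∈ Set.Icc (0 : ℝ) 1, h t ≤ B)
    (hmid : ∀ s ∈ Set.Icc (0 : ℝ) 1, ∀ t ∈ Set.Icc (0 : ℝ) 1, h ((s + t) / 2) ≤ (h s + h t) / 2)
    {t : ℝ} (ht : t ∈ Set.Icc (0 : ℝ) 1) : h t ≤ (1 - t) * h 0 + t * h 1 := by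
  set M := |B| + |h 0| + |h 1| with hM
  -- reflecting at the nearer end point halves any bound for the excess over the chord
  have key : ∀ n : ℕ, ∀ t ∈ Set.Icc (0 : ℝ) 1, h t - ((1 - t) * h 0 + t * h 1) ≤ M / 2 ^ n := by
    intro n
    induction n with
    | zero =>
      rintro t ⟨h0, h1⟩
      have e0 : -|h 0| ≤ (1 - t) * h 0 := by
        nlinarith [neg_abs_le (h 0), abs_nonneg (h 0)]
      have e1 : -|h 1| ≤ t * h 1 := by
        nlinarith [neg_abs_le (h 1), abs_nonneg (h 1)]
      have := hB t ⟨h0, h1⟩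
      have := le_abs_self B
      rw [pow_zero, div_one]
      linarith
    | succ n ih =>
      rintro t ⟨h0, h1⟩
      have e : M / 2 ^ (n + 1) = M / 2 ^ n / 2 := by rw [pow_succ, div_div]
      rw [e]
      rcases le_total t (1 / 2) with h2 | h2
      · have hm := hmid 0 ⟨le_rfl, zero_le_one⟩ (2 * t) ⟨by linarith, by linarith⟩
        have hi := ih (2 * t) ⟨by linarith, by linarith⟩
        rw [show (0 + 2 * t) / 2 = t by ring] at hm
        linarith
      · have hm := hmid (2 * t - 1) ⟨by linarith, by linarith⟩ 1 ⟨zero_le_one, le_rfl⟩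
        have hi := ih (2 * t - 1) ⟨by linarith, by linarith⟩
        rw [show (2 * t - 1 + 1) / 2 = t by ring] at hm
        linarith
  have hlim : Filter.Tendsto (fun n : ℕ ↦ M / 2 ^ n) Filter.atTop (nhds 0) := by
    have := (tendsto_pow_atTop_nhds_zero_of_lt_one (r := (2⁻¹ : ℝ)) (by norm_num)
      (by norm_num)).const_mul M
    simpa [div_eq_mul_inv] using this
  have := ge_of_tendsto' hlim fun n ↦ key n t ht
  linarith

theorem rpow_half_mul_add_le {p a b : ℝ} (hp : 1 ≤ p) (ha : 0 ≤ a) (hb : 0 ≤ b) :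
    (2⁻¹ * a + 2⁻¹ * b) ^ p ≤ 2⁻¹ * a ^ p + 2⁻¹ * b ^ p := by
  have := (convexOn_rpow hp).2 ha hb (show (0 : ℝ) ≤ 2⁻¹ by norm_num)
    (show (0 : ℝ) ≤ 2⁻¹ by norm_num) (by norm_num)
  simpa using this

theorem rpow_norm_smul_add_le {X : Type*} [NormedAddCommGroup X] [NormedSpace ℝ X] {p : ℝ}
    (hp : 1 ≤ p) (x y : X) : ‖(2⁻¹ : ℝ) • (x + y)‖ ^ p ≤ (‖x‖ ^ p + ‖y‖ ^ p) / 2 := by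
  have h := rpow_half_mul_add_le hp (norm_nonneg x) (norm_nonneg y)
  refine le_trans (Real.rpow_le_rpow (norm_nonneg _) ?_ (by linarith)) (h.trans_eq (by ring))
  rw [norm_smul, Real.norm_of_nonneg (by norm_num)]
  linarith [norm_add_le x y]

section Renorm

variable {𝕜 X : Type*} [RCLike 𝕜] [NormedAddCommGroup X] [NormedSpace 𝕜 X] {p : ℝ}

namespace DyadicTree

/-- Apply `φ` to all leaf labels. -/
def map {X Y : Type*} (φ : X → Y) : DyadicTree X → DyadicTree Y
  | leaf x => leaf (φ x)
  | node l r => node (l.map φ) (r.map φ)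

theorem energy_map_smul (c : 𝕜) (T : DyadicTree X) :
    (T.map (c • ·)).energy p = ‖c‖ ^ p * T.energy p := by
  induction T with
  | leaf x => rw [map, energy, energy, norm_smul, Real.mul_rpow (norm_nonneg _) (norm_nonneg _)]
  | node l r hl hr => rw [map, energy, energy, hl, hr]; ring

end DyadicTree

variable [NormedSpace ℝ X] [IsScalarTower ℝ 𝕜 X]

/-- The `p`-th root of a midpoint convex, absolutely `p`-homogeneous function dominated by `‖·‖ ^ p`
is a seminorm. -/
theorem exists_seminorm_rpow_eq (hp : 1 ≤ p) {g : X → ℝ} (hg0 : ∀ x, 0 ≤ g x)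
    (hg1 : ∀ x, g x ≤ ‖x‖ ^ p) (hsmul : ∀ (c : 𝕜) x, g (c • x) = ‖c‖ ^ p * g x)
    (hmid : ∀ x y, g ((2⁻¹ : ℝ) • (x + y)) ≤ (g x + g y) / 2) :
    ∃ N : Seminorm 𝕜 X, ∀ x, N x ^ p = g x := by
  have hp0 : 0 < p := by linarith
  have hsmulR : ∀ (r : ℝ) x, g (r • x) = |r| ^ p * g x := by
    intro r x
    rw [RCLike.real_smul_eq_coe_smul (K := 𝕜), hsmul, RCLike.norm_ofReal]
  have hconv : ∀ x y : X, ∀ t ∈ Set.Icc (0 : ℝ) 1,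
      g ((1 - t) • x + t • y) ≤ (1 - t) * g x + t * g y := by
    intro x y t ht
    have := le_chord_of_midpoint_le (h := fun t : ℝ ↦ g ((1 - t) • x + t • y))
      (B := (‖x‖ + ‖y‖) ^ p) (fun t ht ↦ ?_) (fun s _ t _ ↦ ?_) ht
    · simpa using this
    · refine (hg1 _).trans (Real.rpow_le_rpow (norm_nonneg _) ((norm_add_le _ _).trans ?_) hp0.le)
      rw [norm_smul, norm_smul, Real.norm_of_nonneg (by linarith [ht.2]), Real.norm_of_nonneg ht.1]
      nlinarith [norm_nonneg x, norm_nonneg y, ht.1, ht.2]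
    · refine le_trans (le_of_eq ?_) (hmid _ _)
      congr 1
      module
  have hroot : ∀ x, (g x ^ (1 / p)) ^ p = g x := fun x ↦ by
    rw [← Real.rpow_mul (hg0 x), one_div_mul_cancel hp0.ne', Real.rpow_one]
  have hroot0 : ∀ x, 0 ≤ g x ^ (1 / p) := fun x ↦ Real.rpow_nonneg (hg0 x) _
  refine ⟨Seminorm.of (fun x ↦ g x ^ (1 / p)) (fun x y ↦ ?_) (fun c x ↦ ?_), hroot⟩
  · refine le_of_forall_pos_le_add fun δ hδ ↦ ?_
    set a := g x ^ (1 / p) + δ / 2 with ha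
    set b := g y ^ (1 / p) + δ / 2 with hb
    have ha0 : 0 < a := by have := hroot0 x; positivity
    have hb0 : 0 < b := by have := hroot0 y; positivity
    have hunit : ∀ z : X, ∀ r : ℝ, 0 < r → g z ^ (1 / p) ≤ r → g (r⁻¹ • z) ≤ 1 := by
      intro z r hr hz
      rw [hsmulR, abs_of_pos (inv_pos.2 hr), Real.inv_rpow hr.le, inv_mul_le_one₀ (by positivity),
        ← hroot z]
      exact Real.rpow_le_rpow (hroot0 z) hz hp0.le
    have hx := hunit x a ha0 (by linarith)
    have hy := hunit y b hb0 (by linarith)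
    have ht : b / (a + b) ∈ Set.Icc (0 : ℝ) 1 :=
      ⟨by positivity, (div_le_one (by positivity)).2 (by linarith)⟩
    have h1 : 1 - b / (a + b) = a / (a + b) := by field_simp; ring
    have hxy := hconv (a⁻¹ • x) (b⁻¹ • y) _ ht
    rw [h1] at hxy
    have hle : g ((a / (a + b)) • a⁻¹ • x + (b / (a + b)) • b⁻¹ • y) ≤ 1 := by
      calc _ ≤ _ := hxy
        _ ≤ a / (a + b) * 1 + b / (a + b) * 1 := by gcongr
        _ = 1 := by field_simp
    have e : x + y = (a + b) • ((a / (a + b)) • a⁻¹ • x + (b / (a + b)) • b⁻¹ • y) := by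
      rw [smul_add, smul_smul, smul_smul, smul_smul, smul_smul,
        show (a + b) * (a / (a + b)) * a⁻¹ = 1 by field_simp,
        show (a + b) * (b / (a + b)) * b⁻¹ = 1 by field_simp, one_smul, one_smul]
    have hsum : g (x + y) ≤ (a + b) ^ p := by
      rw [e, hsmulR, abs_of_pos (by positivity)]
      exact mul_le_of_le_one_right (by positivity) hle
    calc g (x + y) ^ (1 / p) ≤ ((a + b) ^ p) ^ (1 / p) :=
          Real.rpow_le_rpow (hg0 _) hsum (by positivity)
      _ = a + b := by
          rw [← Real.rpow_mul (by positivity), mul_one_div_cancel hp0.ne', Real.rpow_one]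
      _ = _ := by rw [ha, hb]; ring
  · rw [hsmul, Real.mul_rpow (by positivity) (hg0 x), ← Real.rpow_mul (norm_nonneg c),
      mul_one_div_cancel hp0.ne', Real.rpow_one]

namespace DyadicTree

theorem mean_map_smul (c : 𝕜) (T : DyadicTree X) : (T.map (c • ·)).mean = c • T.mean := by
  have : SMulCommClass ℝ 𝕜 X := IsScalarTower.to_smulCommClass
  induction T with
  | leaf x => rfl
  | node l r hl hr => rw [map, mean, mean, hl, hr, ← smul_add, smul_comm]

theorem deviation_map_smul (c : 𝕜) (T : DyadicTree X) :
    (T.map (c • ·)).deviation p = ‖c‖ ^ p * T.deviation p := by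
  have : SMulCommClass ℝ 𝕜 X := IsScalarTower.to_smulCommClass
  induction T with
  | leaf x => rw [map, deviation, deviation, mul_zero]
  | node l r hl hr =>
    rw [map, deviation, deviation, hl, hr, mean_map_smul, mean_map_smul, ← smul_sub,
      smul_comm _ c, norm_smul c, Real.mul_rpow (norm_nonneg _) (norm_nonneg _)]
    ring

theorem rpow_norm_mean_le_energy (hp : 1 ≤ p) (T : DyadicTree X) :
    ‖T.mean‖ ^ p ≤ T.energy p := by
  induction T with
  | leaf x => exact le_rfl
  | node l r hl hr =>
    rw [mean, energy]
    exact (rpow_norm_smul_add_le hp _ _).trans (by linarith)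

/-- Pisier's renorming: `N x ^ p` is the infimum of `energy - lam * deviation` over all trees with
mean `x`. Joining two trees at a new root gives the convexity inequality. -/
theorem exists_seminorm_of_deviation_le (𝕜 : Type*) [RCLike 𝕜] [NormedSpace 𝕜 X]
    [IsScalarTower ℝ 𝕜 X] (hp : 1 ≤ p) {lam δ : ℝ} (hlam : 0 ≤ lam) (hδ : 0 ≤ δ)
    (h : ∀ T : DyadicTree X, δ * T.energy p ≤ T.energy p - lam * T.deviation p) :
    ∃ N : Seminorm 𝕜 X, (∀ x, δ * ‖x‖ ^ p ≤ N x ^ p ∧ N x ^ p ≤ ‖x‖ ^ p) ∧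
      ∀ x y, N ((2⁻¹ : ℝ) • (x + y)) ^ p ≤
        (N x ^ p + N y ^ p) / 2 - lam * ‖(2⁻¹ : ℝ) • (x - y)‖ ^ p := by
  have hp0 : 0 < p := by linarith
  let cost : DyadicTree X → ℝ := fun T ↦ T.energy p - lam * T.deviation p
  let g : X → ℝ := fun x ↦ ⨅ T : {T : DyadicTree X // T.mean = x}, cost T
  have hcost : ∀ T : DyadicTree X, δ * ‖T.mean‖ ^ p ≤ cost T := fun T ↦
    (mul_le_mul_of_nonneg_left (T.rpow_norm_mean_le_energy hp) hδ).trans (h T)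
  have hg_le : ∀ T : DyadicTree X, g T.mean ≤ cost T := by
    intro T
    have hb : BddBelow (Set.range fun T' : {T' : DyadicTree X // T'.mean = T.mean} ↦ cost T') :=
      ⟨δ * ‖T.mean‖ ^ p, by
        rintro _ ⟨⟨T', hT'⟩, rfl⟩
        have := hcost T'
        rwa [hT'] at this⟩
    exact ciInf_le hb ⟨T, rfl⟩
  have hle_g : ∀ (x : X) (a : ℝ), (∀ T : DyadicTree X, T.mean = x → a ≤ cost T) → a ≤ g x := by
    intro x a ha
    have : Nonempty {T : DyadicTree X // T.mean = x} := ⟨⟨leaf x, rfl⟩⟩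
    exact le_ciInf fun T ↦ ha T T.2
  have hg_low : ∀ x, δ * ‖x‖ ^ p ≤ g x := fun x ↦
    hle_g x _ fun T hT ↦ by rw [← hT]; exact hcost T
  have hg0 : ∀ x, 0 ≤ g x := fun x ↦ le_trans (by positivity) (hg_low x)
  have hg1 : ∀ x, g x ≤ ‖x‖ ^ p := by
    intro x
    have := hg_le (leaf x)
    simpa [cost, mean, energy, deviation] using this
  have hsmul_le : ∀ (c : 𝕜) x, c ≠ 0 → g (c • x) ≤ ‖c‖ ^ p * g x := by
    intro c x hc
    have hc0 : 0 < ‖c‖ ^ p := Real.rpow_pos_of_pos (norm_pos_iff.2 hc) p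
    rw [mul_comm, ← div_le_iff₀ hc0]
    refine hle_g x _ fun T hT ↦ ?_
    rw [div_le_iff₀ hc0, ← hT, ← mean_map_smul]
    refine (hg_le _).trans (le_of_eq ?_)
    simp only [cost]
    rw [energy_map_smul, deviation_map_smul]
    ring
  have hsmul : ∀ (c : 𝕜) x, g (c • x) = ‖c‖ ^ p * g x := by
    intro c x
    rcases eq_or_ne c 0 with rfl | hc
    · rw [zero_smul, norm_zero, Real.zero_rpow hp0.ne', zero_mul]
      refine le_antisymm ((hg1 0).trans_eq ?_) (hg0 0)
      rw [norm_zero, Real.zero_rpow hp0.ne']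
    · refine le_antisymm (hsmul_le c x hc) ?_
      have h2 := hsmul_le c⁻¹ (c • x) (inv_ne_zero hc)
      have hc0 : 0 < ‖c‖ ^ p := Real.rpow_pos_of_pos (norm_pos_iff.2 hc) p
      rwa [inv_smul_smul₀ hc, norm_inv, Real.inv_rpow (norm_nonneg c), le_inv_mul_iff₀ hc0] at h2
  have hmid : ∀ x y, g ((2⁻¹ : ℝ) • (x + y)) ≤
      (g x + g y) / 2 - lam * ‖(2⁻¹ : ℝ) • (x - y)‖ ^ p := by
    intro x y
    have hT : ∀ T T' : DyadicTree X, T.mean = x → T'.mean = y →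
        g ((2⁻¹ : ℝ) • (x + y)) ≤
          (cost T + cost T') / 2 - lam * ‖(2⁻¹ : ℝ) • (x - y)‖ ^ p := by
      rintro T T' rfl rfl
      refine (hg_le (node T T')).trans (le_of_eq ?_)
      simp only [cost, energy, deviation]
      ring
    have h1 : ∀ T' : DyadicTree X, T'.mean = y →
        2 * (g ((2⁻¹ : ℝ) • (x + y)) + lam * ‖(2⁻¹ : ℝ) • (x - y)‖ ^ p) - cost T' ≤ g x :=
      fun T' hT' ↦ hle_g x _ fun T hTx ↦ by linarith [hT T T' hTx hT']
    have h2 : 2 * (g ((2⁻¹ : ℝ) • (x + y)) + lam * ‖(2⁻¹ : ℝ) • (x - y)‖ ^ p) - g x ≤ g y :=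
      hle_g y _ fun T' hT' ↦ by linarith [h1 T' hT']
    linarith
  obtain ⟨N, hN⟩ := exists_seminorm_rpow_eq (𝕜 := 𝕜) hp hg0 hg1 hsmul fun x y ↦
    (hmid x y).trans (sub_le_self _ (by positivity))
  refine ⟨N, fun x ↦ ?_, fun x y ↦ ?_⟩
  · rw [hN]
    exact ⟨hg_low x, hg1 x⟩
  · rw [hN, hN, hN]
    exact hmid x y

end DyadicTree

end Renorm

/-! ### The modulus of convexity and the two-point inequality -/

section TwoPoint

/-- Clarkson's inequality for real numbers, with exponent `p ≥ 2`. -/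
theorem rpow_half_add_rpow_half_le {p s : ℝ} (hp : 2 ≤ p) (hs0 : 0 ≤ s) (hs1 : s ≤ 1) :
    ((1 + s) / 2) ^ p + ((1 - s) / 2) ^ p ≤ (1 + s ^ p) / 2 := by
  have hq : 1 ≤ p / 2 := by linarith
  have hsq : ∀ u : ℝ, 0 ≤ u → u ^ p = (u ^ 2) ^ (p / 2) := by
    intro u hu
    rw [← Real.rpow_natCast u 2, ← Real.rpow_mul hu]
    congr 1
    push_cast
    ring
  have h1 := Real.add_rpow_le_rpow_add (a := ((1 + s) / 2) ^ 2) (b := ((1 - s) / 2) ^ 2)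
    (by positivity) (by positivity) hq
  have h2 := rpow_half_mul_add_le (a := 1) (b := s ^ 2) hq (by norm_num) (by positivity)
  rw [hsq _ (show 0 ≤ (1 + s) / 2 by linarith), hsq _ (show 0 ≤ (1 - s) / 2 by linarith),
    hsq s hs0]
  rw [show ((1 + s) / 2) ^ 2 + ((1 - s) / 2) ^ 2 = 2⁻¹ * 1 + 2⁻¹ * s ^ 2 by ring] at h1
  rw [Real.one_rpow] at h2
  linarith

theorem rpow_sub_le {p m δ : ℝ} (hp : 1 ≤ p) (hm : 0 < m) (hδ : 0 ≤ δ) (hδm : δ ≤ m) :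
    (m - δ) ^ p ≤ m ^ p - δ * m ^ (p - 1) := by
  have hu0 : 0 ≤ 1 - δ / m := by rw [sub_nonneg, div_le_one hm]; exact hδm
  have hu1 : 1 - δ / m ≤ 1 := by rw [sub_le_self_iff]; positivity
  have h := Real.rpow_le_rpow_of_exponent_ge' hu0 hu1 zero_le_one hp
  rw [Real.rpow_one] at h
  have e : m - δ = m * (1 - δ / m) := by field_simp
  have e2 : m ^ p = m ^ (p - 1) * m := by
    rw [← Real.rpow_add_one hm.ne']; congr 1; ring
  rw [e, Real.mul_rpow hm.le hu0]
  calc m ^ p * (1 - δ / m) ^ p ≤ m ^ p * (1 - δ / m) := by gcongr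
    _ = _ := by rw [e2]; field_simp

variable {𝕜 X : Type*} [RCLike 𝕜] [NormedAddCommGroup X] [NormedSpace 𝕜 X] {N : Seminorm 𝕜 X}
  {p K : ℝ}

theorem Seminorm.apply_ofReal_smul (N : Seminorm 𝕜 X) {r : ℝ} (hr : 0 ≤ r) (x : X) :
    N ((r : 𝕜) • x) = r * N x := by
  rw [map_smul_eq_mul, RCLike.norm_ofReal, abs_of_nonneg hr]

theorem Seminorm.apply_inv_two_smul (N : Seminorm 𝕜 X) (x : X) :
    N ((2⁻¹ : 𝕜) • x) = N x / 2 := by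
  rw [map_smul_eq_mul, norm_inv, RCLike.norm_ofNat, inv_mul_eq_div]

/-- For a unit vector `x` and a vector `y` in the unit ball, either the norms differ by a fixed
proportion of the distance and Clarkson's inequality on the line suffices, or `y` may be normalized
and the modulus of convexity applies. -/
theorem HasPowerTypeModulus.rpow_midpoint_le_of_unit (h : HasPowerTypeModulus N p K) (hK : 0 < K)
    (hp : 2 ≤ p) {x y : X} (hx : N x = 1) (hy : N y ≤ 1) :
    N ((2⁻¹ : 𝕜) • (x + y)) ^ p ≤
      (1 + N y ^ p) / 2 - min ((1 / 8) ^ p) (K / 2 * (3 / 4) ^ p * (3 / 4) ^ p) * N (x - y) ^ p := by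
  set s := N y with hs
  set d := N (x - y) with hd
  have hs0 : 0 ≤ s := apply_nonneg N y
  have hd0 : 0 ≤ d := apply_nonneg N _
  have hp0 : 0 < p := by linarith
  have hcl := rpow_half_add_rpow_half_le hp hs0 hy
  have hdp : 0 ≤ d ^ p := by positivity
  rcases le_or_gt (d / 4) (1 - s) with hcase | hcase
  · have h1 : N ((2⁻¹ : 𝕜) • (x + y)) ≤ (1 + s) / 2 := by
      rw [N.apply_inv_two_smul]
      have := map_add_le_add N x y
      linarith
    have h2 := Real.rpow_le_rpow (apply_nonneg N _) h1 hp0.le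
    have h3 : (1 / 8) ^ p * d ^ p ≤ ((1 - s) / 2) ^ p := by
      rw [← Real.mul_rpow (by norm_num) hd0]
      exact Real.rpow_le_rpow (by positivity) (by linarith) hp0.le
    have h4 := mul_le_mul_of_nonneg_right
      (min_le_left ((1 / 8 : ℝ) ^ p) (K / 2 * (3 / 4) ^ p * (3 / 4) ^ p)) hdp
    linarith
  · have hd2 : d ≤ 1 + s := by
      have := map_sub_le_add N x y
      linarith
    have hs2 : 1 / 2 ≤ s := by linarith
    have hs' : 0 < s := by linarith
    set z : X := ((s⁻¹ : ℝ) : 𝕜) • y with hz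
    have hyz : y = ((s : ℝ) : 𝕜) • z := by
      rw [hz, smul_smul, ← RCLike.ofReal_mul, mul_inv_cancel₀ hs'.ne', RCLike.ofReal_one, one_smul]
    have hNz : N z = 1 := by
      rw [hz, N.apply_ofReal_smul (by positivity), ← hs, inv_mul_cancel₀ hs'.ne']
    have hzy : N (z - y) = 1 - s := by
      have e : z - y = ((1 - s : ℝ) : 𝕜) • z := by
        rw [RCLike.ofReal_sub, RCLike.ofReal_one, sub_smul, one_smul, ← hyz]
      rw [e, N.apply_ofReal_smul (by linarith), hNz, mul_one]
    have hxz : 3 / 4 * d ≤ N (x - z) := by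
      have := map_add_le_add N (x - z) (z - y)
      rw [sub_add_sub_cancel, hzy] at this
      linarith
    have hmod := h x z hx hNz
    set δ := K / 2 * (3 / 4) ^ p * d ^ p with hδ
    have hδ0 : 0 ≤ δ := by positivity
    have hbound : N ((2⁻¹ : 𝕜) • (x + y)) ≤ (1 + s) / 2 - δ := by
      have e : (2⁻¹ : 𝕜) • (x + y) =
          (s : 𝕜) • ((2⁻¹ : 𝕜) • (x + z)) + ((1 - s : ℝ) : 𝕜) • ((2⁻¹ : 𝕜) • x) := by
        nth_rw 1 [hyz]
        rw [RCLike.ofReal_sub, RCLike.ofReal_one]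
        module
      have h1 := map_add_le_add N ((s : 𝕜) • ((2⁻¹ : 𝕜) • (x + z)))
        (((1 - s : ℝ) : 𝕜) • ((2⁻¹ : 𝕜) • x))
      rw [← e, N.apply_ofReal_smul hs0, N.apply_ofReal_smul (by linarith),
        N.apply_inv_two_smul x, hx] at h1
      have h2 : (3 / 4 : ℝ) ^ p * d ^ p ≤ N (x - z) ^ p := by
        rw [← Real.mul_rpow (by norm_num) hd0]
        exact Real.rpow_le_rpow (by positivity) hxz hp0.le
      have h3 : δ ≤ s * (K * N (x - z) ^ p) := by
        calc δ = 1 / 2 * (K * ((3 / 4) ^ p * d ^ p)) := by rw [hδ]; ring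
          _ ≤ _ := by gcongr
      have h4 := mul_le_mul_of_nonneg_left hmod hs0
      linarith
    have hN0 := apply_nonneg N ((2⁻¹ : 𝕜) • (x + y))
    have hpow := rpow_sub_le (p := p) (m := (1 + s) / 2) (by linarith) (by linarith) hδ0
      (by linarith)
    have h5 := Real.rpow_le_rpow hN0 hbound hp0.le
    have h6 : (3 / 4 : ℝ) ^ p ≤ ((1 + s) / 2) ^ (p - 1) := by
      calc (3 / 4 : ℝ) ^ p ≤ (3 / 4) ^ (p - 1) :=
            Real.rpow_le_rpow_of_exponent_ge (by norm_num) (by norm_num) (by linarith)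
        _ ≤ _ := Real.rpow_le_rpow (by norm_num) (by linarith) (by linarith)
    have h7 := mul_le_mul_of_nonneg_left h6 hδ0
    have h8 := mul_le_mul_of_nonneg_right
      (min_le_right ((1 / 8 : ℝ) ^ p) (K / 2 * (3 / 4) ^ p * (3 / 4) ^ p)) hdp
    have h9 : 0 ≤ ((1 - s) / 2) ^ p := Real.rpow_nonneg (by linarith) _
    have h10 : K / 2 * (3 / 4) ^ p * (3 / 4) ^ p * d ^ p = δ * (3 / 4) ^ p := by rw [hδ]; ring
    linarith

theorem HasPowerTypeModulus.exists_rpow_midpoint_le (h : HasPowerTypeModulus N p K) (hK : 0 < K)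
    (hp : 2 ≤ p) : ∃ c : ℝ, 0 < c ∧ ∀ x y : X,
      N ((2⁻¹ : 𝕜) • (x + y)) ^ p ≤ (N x ^ p + N y ^ p) / 2 - c * N (x - y) ^ p := by
  refine ⟨min ((1 / 8) ^ p) (K / 2 * (3 / 4) ^ p * (3 / 4) ^ p), by positivity, ?_⟩
  set c := min ((1 / 8 : ℝ) ^ p) (K / 2 * (3 / 4) ^ p * (3 / 4) ^ p)
  have hp0 : 0 < p := by linarith
  have key : ∀ x y : X, N y ≤ N x →
      N ((2⁻¹ : 𝕜) • (x + y)) ^ p ≤ (N x ^ p + N y ^ p) / 2 - c * N (x - y) ^ p := by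
    intro x y hxy
    rcases (apply_nonneg N x).eq_or_lt with hx | hx
    · have hy : N y = 0 := le_antisymm (hxy.trans hx.ge) (apply_nonneg N y)
      have h1 : N (x - y) = 0 :=
        le_antisymm ((map_sub_le_add N x y).trans (by linarith)) (apply_nonneg N _)
      have h2 : N (x + y) = 0 :=
        le_antisymm ((map_add_le_add N x y).trans (by linarith)) (apply_nonneg N _)
      rw [N.apply_inv_two_smul, h1, h2, hy, ← hx, zero_div, Real.zero_rpow hp0.ne']
      simp
    · set r := N x with hr
      have hi : 0 ≤ r⁻¹ := by positivity
      have h1 := h.rpow_midpoint_le_of_unit hK hp (x := ((r⁻¹ : ℝ) : 𝕜) • x)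
        (y := ((r⁻¹ : ℝ) : 𝕜) • y) (by rw [N.apply_ofReal_smul hi, ← hr, inv_mul_cancel₀ hx.ne'])
        (by rw [N.apply_ofReal_smul hi, inv_mul_le_one₀ hx]; exact hxy)
      rw [← smul_add, ← smul_sub, smul_comm, N.apply_ofReal_smul hi, N.apply_ofReal_smul hi,
        N.apply_ofReal_smul hi, Real.mul_rpow hi (apply_nonneg _ _),
        Real.mul_rpow hi (apply_nonneg _ _), Real.mul_rpow hi (apply_nonneg _ _),
        Real.inv_rpow hx.le] at h1
      have hrp : 0 < r ^ p := by positivity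
      have h2 := mul_le_mul_of_nonneg_left h1 hrp.le
      rw [mul_inv_cancel_left₀ hrp.ne'] at h2
      refine h2.trans (le_of_eq ?_)
      change r ^ p * ((1 + (r ^ p)⁻¹ * N y ^ p) / 2 - c * ((r ^ p)⁻¹ * N (x - y) ^ p)) = _
      field_simp
  intro x y
  rcases le_total (N y) (N x) with hxy | hxy
  · exact key x y hxy
  · have := key y x hxy
    rwa [add_comm y x, map_sub_rev N y x, add_comm (N y ^ p)] at this

theorem twoPointInequality_of_rpow_midpoint_le {c : ℝ} (hc : ∀ x y : X,
      N ((2⁻¹ : 𝕜) • (x + y)) ^ p ≤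
        (N x ^ p + N y ^ p) / 2 - c * N ((2⁻¹ : 𝕜) • (x - y)) ^ p)
    (hKc : 1 / K ^ p ≤ c) : TwoPointInequality N p K := by
  intro a b
  have h := hc (a + b) (a - b)
  have e1 : (2⁻¹ : 𝕜) • (a + b + (a - b)) = a := by module
  have e2 : (2⁻¹ : 𝕜) • (a + b - (a - b)) = b := by module
  rw [e1, e2] at h
  have h2 := mul_le_mul_of_nonneg_right hKc (Real.rpow_nonneg (apply_nonneg N b) p)
  have e3 : 2 / K ^ p * N b ^ p = 2 * (1 / K ^ p * N b ^ p) := by ring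
  rw [e3]
  linarith

theorem HasPowerTypeModulus.exists_twoPointInequality (h : HasPowerTypeModulus N p K) (hK : 0 < K)
    (hp : 2 ≤ p) : ∃ K' : ℝ≥0, 0 < K' ∧ TwoPointInequality N p K' := by
  obtain ⟨c, hc, hmid⟩ := h.exists_rpow_midpoint_le hK hp
  have hp0 : 0 < p := by linarith
  have hpos : 0 < (c * 2 ^ p) ^ (-(1 / p)) := by positivity
  refine ⟨((c * 2 ^ p) ^ (-(1 / p))).toNNReal, Real.toNNReal_pos.2 hpos, ?_⟩
  rw [Real.coe_toNNReal _ hpos.le]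
  refine twoPointInequality_of_rpow_midpoint_le (c := c * 2 ^ p) (fun x y ↦ ?_) (le_of_eq ?_)
  · refine (hmid x y).trans (le_of_eq ?_)
    rw [N.apply_inv_two_smul, Real.div_rpow (apply_nonneg _ _) (by norm_num)]
    field_simp
  · rw [← Real.rpow_mul (by positivity), neg_mul, one_div_mul_cancel hp0.ne', Real.rpow_neg_one,
      one_div, inv_inv]

/-- The fork inequality: the two-point inequality for `x - y`, `y - z` and for `x - y`, `y - w`,
combined with the convexity of the `p`-th power. -/
theorem TwoPointInequality.fork (h : TwoPointInequality N p K) (hK : 0 < K) (hp : 1 ≤ p)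
    (x y z w : X) :
    2 * (2 ^ p)⁻¹ * (N (x - z) ^ p + N (x - w) ^ p) + 4 * ((4 * K) ^ p)⁻¹ * N (z - w) ^ p ≤
      2 * N (x - y) ^ p + (N (y - z) ^ p + N (y - w) ^ p) := by
  have hp0 : 0 < p := by linarith
  have h2 : (0 : ℝ) < 2 ^ p := by positivity
  have hKp : 0 < K ^ p := by positivity
  have hpt : ∀ z : X, 2 * (2 ^ p)⁻¹ * N (x - z) ^ p +
      2 * (K ^ p)⁻¹ * (2 ^ p)⁻¹ * N (x - (2 : 𝕜) • y + z) ^ p ≤ N (x - y) ^ p + N (y - z) ^ p := by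
    intro z
    have := h ((2⁻¹ : 𝕜) • (x - z)) ((2⁻¹ : 𝕜) • (x - (2 : 𝕜) • y + z))
    have e1 : (2⁻¹ : 𝕜) • (x - z) + (2⁻¹ : 𝕜) • (x - (2 : 𝕜) • y + z) = x - y := by module
    have e2 : (2⁻¹ : 𝕜) • (x - z) - (2⁻¹ : 𝕜) • (x - (2 : 𝕜) • y + z) = y - z := by module
    rw [e1, e2, N.apply_inv_two_smul, N.apply_inv_two_smul,
      Real.div_rpow (apply_nonneg _ _) (by norm_num),
      Real.div_rpow (apply_nonneg _ _) (by norm_num)] at this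
    refine le_trans (le_of_eq ?_) this
    field_simp
  set A := N (x - (2 : 𝕜) • y + z) with hA
  set B := N (x - (2 : 𝕜) • y + w) with hB
  have hA0 : 0 ≤ A := apply_nonneg _ _
  have hB0 : 0 ≤ B := apply_nonneg _ _
  have hzw : N (z - w) ≤ A + B := by
    have := map_sub_le_add N (x - (2 : 𝕜) • y + z) (x - (2 : 𝕜) • y + w)
    rwa [add_sub_add_left_eq_sub] at this
  have hconv := rpow_half_mul_add_le hp hA0 hB0
  have hzw2 : (2 ^ p)⁻¹ * N (z - w) ^ p ≤ 2⁻¹ * A ^ p + 2⁻¹ * B ^ p := by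
    refine le_trans ?_ hconv
    rw [← Real.inv_rpow (by norm_num), ← Real.mul_rpow (by norm_num) (apply_nonneg _ _), ← mul_add]
    exact Real.rpow_le_rpow (mul_nonneg (by norm_num) (apply_nonneg _ _)) (by gcongr) hp0.le
  have h4 : (4 * K) ^ p = 2 ^ p * 2 ^ p * K ^ p := by
    rw [show (4 : ℝ) = 2 * 2 by norm_num, Real.mul_rpow (by norm_num) hK.le,
      Real.mul_rpow (by norm_num) (by norm_num)]
  have hfin : 4 * ((4 * K) ^ p)⁻¹ * N (z - w) ^ p ≤
      2 * (K ^ p)⁻¹ * (2 ^ p)⁻¹ * A ^ p + 2 * (K ^ p)⁻¹ * (2 ^ p)⁻¹ * B ^ p := by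
    calc 4 * ((4 * K) ^ p)⁻¹ * N (z - w) ^ p
        = 4 * (K ^ p)⁻¹ * (2 ^ p)⁻¹ * ((2 ^ p)⁻¹ * N (z - w) ^ p) := by rw [h4]; field_simp
      _ ≤ 4 * (K ^ p)⁻¹ * (2 ^ p)⁻¹ * (2⁻¹ * A ^ p + 2⁻¹ * B ^ p) := by gcongr
      _ = _ := by ring
  have hz := hpt z
  have hw := hpt w
  linarith

end TwoPoint

/-! ### The two implications -/

section Final

variable {𝕜 : Type w} [RCLike 𝕜] {X : Type u} [NormedAddCommGroup X] [NormedSpace 𝕜 X] {p : ℝ}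

theorem IsMarkovConvexWith.mono {C C' : ℝ≥0} (hp : 0 ≤ p) (hCC : C ≤ C')
    (h : IsMarkovConvexWith.{u, v} X p C) : IsMarkovConvexWith.{u, v} X p C' := by
  intro Ω S _ _ P _ κ _ ξ ξ' hξ hξ' f hf
  refine (h Ω S P κ ξ ξ' hξ hξ' f hf).trans ?_
  gcongr

/-- A two-point inequality for a seminorm equivalent to the norm implies Markov convexity, by way of
the fork inequality. -/
theorem TwoPointInequality.isMarkovConvexWith {N : Seminorm 𝕜 X} {a b K : ℝ≥0} (ha : 0 < a)
    (hN : ∀ x, a * ‖x‖ ≤ N x ∧ N x ≤ b * ‖x‖) (hK : 0 < K) (hp : 1 ≤ p)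
    (h : TwoPointInequality N p K) : IsMarkovConvexWith.{u, v} X p (4 * K * (b / a)) := by
  intro Ω S _ _ P _ κ _ ξ ξ' hξ hξ' f hf
  have hp0 : 0 < p := by linarith
  have hKr : (0 : ℝ) < K := hK
  have hcont : Continuous N := Seminorm.continuous_of_le (q := b • normSeminorm 𝕜 X)
    (continuous_const.mul continuous_norm) fun x ↦ (hN x).2
  let G : X → X → ℝ≥0∞ := fun x y ↦ ENNReal.ofReal (N (x - y) ^ p)
  have hG : Continuous (Function.uncurry G) :=
    ENNReal.continuous_ofReal.comp
      ((hcont.comp (continuous_fst.sub continuous_snd)).rpow_const fun _ ↦ .inr hp0.le)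
  have hnn : ∀ x, 0 ≤ N x ^ p := fun x ↦ Real.rpow_nonneg (apply_nonneg N x) p
  have hfork : ∀ x y z w, 2 * ENNReal.ofReal (2 ^ p)⁻¹ * (G x z + G x w) +
      4 * ENNReal.ofReal ((4 * K) ^ p)⁻¹ * G z w ≤ 2 * G x y + (G y z + G y w) := by
    intro x y z w
    have hr := ENNReal.ofReal_le_ofReal (h.fork hKr hp x y z w)
    have h1 := hnn (x - z)
    have h2 := hnn (x - w)
    have h3 := hnn (z - w)
    have h4 := hnn (x - y)
    have h5 := hnn (y - z)
    have h6 := hnn (y - w)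
    rw [ENNReal.ofReal_add (by positivity) (by positivity),
      ENNReal.ofReal_add (by positivity) (by positivity), ENNReal.ofReal_mul (by positivity),
      ENNReal.ofReal_mul (by positivity), ENNReal.ofReal_mul (by positivity),
      ENNReal.ofReal_mul (by positivity), ENNReal.ofReal_mul (by positivity),
      ENNReal.ofReal_add (by positivity) (by positivity),
      ENNReal.ofReal_add (by positivity) (by positivity)] at hr
    simpa [G] using hr
  have hsum := tsum_branch_le_of_fork hξ hξ' hf hG hfork
  have hlow : ∀ x y, (a : ℝ≥0∞) ^ p * edist x y ^ p ≤ G x y := by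
    intro x y
    have e : (a : ℝ≥0∞) ^ p * edist x y ^ p = ENNReal.ofReal ((a * ‖x - y‖) ^ p) := by
      rw [← ENNReal.ofReal_rpow_of_nonneg (by positivity) hp0.le, ENNReal.ofReal_mul (by positivity),
        ENNReal.mul_rpow_of_nonneg _ _ hp0.le, ENNReal.ofReal_coe_nnreal, ofReal_norm,
        edist_eq_enorm_sub]
    rw [e]
    exact ENNReal.ofReal_le_ofReal (Real.rpow_le_rpow (by positivity) (hN _).1 hp0.le)
  have hup : ∀ x y, G x y ≤ (b : ℝ≥0∞) ^ p * edist x y ^ p := by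
    intro x y
    have e : (b : ℝ≥0∞) ^ p * edist x y ^ p = ENNReal.ofReal ((b * ‖x - y‖) ^ p) := by
      rw [← ENNReal.ofReal_rpow_of_nonneg (by positivity) hp0.le, ENNReal.ofReal_mul (by positivity),
        ENNReal.mul_rpow_of_nonneg _ _ hp0.le, ENNReal.ofReal_coe_nnreal, ofReal_norm,
        edist_eq_enorm_sub]
    rw [e]
    exact ENNReal.ofReal_le_ofReal (Real.rpow_le_rpow (apply_nonneg _ _) (hN _).2 hp0.le)
  set L := ∑' k : ℕ, ∑' t : ℤ,
    (∫⁻ ω, edist (f (ξ t ω)) (f (ξ' (t - 2 ^ k) t ω)) ^ p ∂P) / 2 ^ ((k : ℝ) * p) with hL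
  set R := ∑' t : ℤ, ∫⁻ ω, edist (f (ξ t ω)) (f (ξ (t - 1) ω)) ^ p ∂P with hR
  have hapow : (a : ℝ≥0∞) ^ p ≠ ⊤ := ENNReal.rpow_ne_top_of_nonneg hp0.le ENNReal.coe_ne_top
  have hbpow : (b : ℝ≥0∞) ^ p ≠ ⊤ := ENNReal.rpow_ne_top_of_nonneg hp0.le ENNReal.coe_ne_top
  have hapow0 : (a : ℝ≥0∞) ^ p ≠ 0 :=
    (ENNReal.rpow_pos (by exact_mod_cast ha) ENNReal.coe_ne_top).ne'
  have hleft : (a : ℝ≥0∞) ^ p * L ≤ ∑' k : ℕ, ENNReal.ofReal (2 ^ p)⁻¹ ^ k *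
      ∑' t : ℤ, ∫⁻ ω, G (f (ξ t ω)) (f (ξ' (t - 2 ^ k) t ω)) ∂P := by
    rw [hL, ← ENNReal.tsum_mul_left]
    refine ENNReal.tsum_le_tsum fun k ↦ ?_
    have e : (2 : ℝ≥0∞) ^ ((k : ℝ) * p) = (ENNReal.ofReal (2 ^ p) : ℝ≥0∞) ^ k := by
      rw [mul_comm, ENNReal.rpow_mul, ENNReal.rpow_natCast,
        ← ENNReal.ofReal_rpow_of_pos (by norm_num)]
      simp
    simp only [div_eq_mul_inv]
    rw [ENNReal.tsum_mul_right, e, ENNReal.ofReal_inv_of_pos (by positivity), ENNReal.inv_pow,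
      ← mul_assoc, mul_comm, ← ENNReal.tsum_mul_left]
    gcongr with t
    rw [← lintegral_const_mul' _ _ hapow]
    exact lintegral_mono fun ω ↦ hlow _ _
  have hright : ∑' t : ℤ, ∫⁻ ω, G (f (ξ (t - 1) ω)) (f (ξ t ω)) ∂P ≤ (b : ℝ≥0∞) ^ p * R := by
    rw [hR, ← ENNReal.tsum_mul_left]
    gcongr with t
    rw [← lintegral_const_mul' _ _ hbpow]
    refine lintegral_mono fun ω ↦ ?_
    rw [edist_comm]
    exact hup _ _
  have hKpow : ENNReal.ofReal ((4 * K) ^ p)⁻¹ = (((4 * K : ℝ≥0) : ℝ≥0∞) ^ p)⁻¹ := by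
    rw [ENNReal.ofReal_inv_of_pos (by positivity),
      ← ENNReal.ofReal_rpow_of_nonneg (by positivity) hp0.le, ← ENNReal.ofReal_coe_nnreal]
    simp
  have hK0 : ((4 * K : ℝ≥0) : ℝ≥0∞) ^ p ≠ 0 :=
    (ENNReal.rpow_pos (by exact_mod_cast (by positivity : 0 < 4 * K)) ENNReal.coe_ne_top).ne'
  have hKt : ((4 * K : ℝ≥0) : ℝ≥0∞) ^ p ≠ ⊤ :=
    ENNReal.rpow_ne_top_of_nonneg hp0.le ENNReal.coe_ne_top
  have hmain : (((4 * K : ℝ≥0) : ℝ≥0∞) ^ p)⁻¹ * ((a : ℝ≥0∞) ^ p * L) ≤ (b : ℝ≥0∞) ^ p * R := by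
    rw [← hKpow]
    exact (mul_le_mul_right hleft _).trans (hsum.trans hright)
  rw [ENNReal.inv_mul_le_iff hK0 hKt, mul_comm ((a : ℝ≥0∞) ^ p),
    ← ENNReal.le_div_iff_mul_le (.inl hapow0) (.inl hapow)] at hmain
  refine hmain.trans (le_of_eq ?_)
  rw [ENNReal.coe_mul (4 * K), ENNReal.coe_div ha.ne', ENNReal.mul_rpow_of_nonneg _ _ hp0.le,
    ENNReal.div_rpow_of_nonneg _ _ hp0.le, div_eq_mul_inv, div_eq_mul_inv]
  ring

/-- The renorming theorem: dyadic trees turn Markov convexity into a norm close to the given one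
that satisfies a midpoint inequality. -/
theorem IsMarkovConvexWith.exists_seminorm [CompleteSpace X] (hp : 1 ≤ p) {C : ℝ≥0} (hC : 0 < C)
    (h : IsMarkovConvexWith.{u, v} X p C) {ε : ℝ} (hε0 : 0 < ε) (hε1 : ε < 1) :
    ∃ N : Seminorm 𝕜 X, (∀ x, (1 - ε) * ‖x‖ ≤ N x ∧ N x ≤ ‖x‖) ∧
      ∀ x y, N ((2⁻¹ : 𝕜) • (x + y)) ^ p ≤ (N x ^ p + N y ^ p) / 2
        - (1 - (1 - ε) ^ p) / (4 * (C : ℝ) ^ p * (p + 1)) * N ((2⁻¹ : 𝕜) • (x - y)) ^ p := by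
  let _ : NormedSpace ℝ X := NormedSpace.restrictScalars ℝ 𝕜 X
  have : IsScalarTower ℝ 𝕜 X := inferInstance
  have hp0 : 0 < p := by linarith
  have hCp : (0 : ℝ) < (C : ℝ) ^ p := Real.rpow_pos_of_pos hC p
  have hη : (1 - ε) ^ p ≤ 1 := Real.rpow_le_one (by linarith) (by linarith) hp0.le
  set lam := (1 - (1 - ε) ^ p) / (4 * (C : ℝ) ^ p * (p + 1)) with hlam
  have hlam0 : 0 ≤ lam := div_nonneg (by linarith) (by positivity)
  obtain ⟨N, hN, hmid⟩ := DyadicTree.exists_seminorm_of_deviation_le (X := X) 𝕜 hp hlam0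
    (δ := (1 - ε) ^ p) (Real.rpow_nonneg (by linarith) p) fun T ↦ by
      have hT := DyadicTree.deviation_le_of_isMarkovConvexWith hp h T
      have e : lam * T.deviation p =
          (1 - (1 - ε) ^ p) * (((C : ℝ) ^ p)⁻¹ * (T.deviation p / (4 * (p + 1)))) := by
        rw [hlam]
        field_simp
      have h1 : ((C : ℝ) ^ p)⁻¹ * (T.deviation p / (4 * (p + 1))) ≤ T.energy p := by
        rwa [inv_mul_le_iff₀ hCp]
      have h2 := mul_le_mul_of_nonneg_left h1 (show 0 ≤ 1 - (1 - ε) ^ p by linarith)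
      rw [e]
      linarith
  have hNx : ∀ x, (1 - ε) * ‖x‖ ≤ N x ∧ N x ≤ ‖x‖ := by
    intro x
    obtain ⟨h1, h2⟩ := hN x
    rw [← Real.mul_rpow (by linarith) (norm_nonneg x)] at h1
    exact ⟨(Real.rpow_le_rpow_iff (mul_nonneg (by linarith) (norm_nonneg x)) (apply_nonneg N x)
      hp0).1 h1, (Real.rpow_le_rpow_iff (apply_nonneg N x) (norm_nonneg x) hp0).1 h2⟩
  have htwo : ∀ x : X, (2⁻¹ : ℝ) • x = (2⁻¹ : 𝕜) • x := fun x ↦ by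
    rw [RCLike.real_smul_eq_coe_smul (K := 𝕜), RCLike.ofReal_inv, RCLike.ofReal_ofNat]
  refine ⟨N, hNx, fun x y ↦ ?_⟩
  have hxy := hmid x y
  rw [htwo, htwo] at hxy
  have h3 := Real.rpow_le_rpow (apply_nonneg N _) (hNx ((2⁻¹ : 𝕜) • (x - y))).2 hp0.le
  have h4 := mul_le_mul_of_nonneg_left h3 hlam0
  linarith

theorem one_div_rpow_le_renorming_constant (hp : 2 ≤ p) {C ε : ℝ} (hC : 0 < C) (hε0 : 0 < ε)
    (hε1 : ε < 1) : 1 / (4 * C / ε ^ (1 / p)) ^ p ≤ (1 - (1 - ε) ^ p) / (4 * C ^ p * (p + 1)) := by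
  have hp0 : 0 < p := by linarith
  have hCp : 0 < C ^ p := by positivity
  have h1 : (1 - ε) ^ p ≤ 1 - ε := by
    have := Real.rpow_le_rpow_of_exponent_ge' (x := 1 - ε) (by linarith) (by linarith)
      zero_le_one (show (1 : ℝ) ≤ p by linarith)
    rwa [Real.rpow_one] at this
  -- Bernoulli's inequality at exponent `p - 1`, for `4 = 1 + 3`
  have h4 : 4 * (p + 1) ≤ (4 : ℝ) ^ p := by
    have hb := one_add_mul_self_le_rpow_one_add (s := (3 : ℝ)) (p := p - 1) (by norm_num)
      (by linarith)
    have e : (4 : ℝ) ^ p = (1 + 3) ^ (p - 1) * 4 := by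
      rw [show (1 + 3 : ℝ) = 4 by norm_num, ← Real.rpow_add_one (by norm_num)]
      congr 1
      ring
    rw [e]
    linarith
  have e : (4 * C / ε ^ (1 / p)) ^ p = 4 ^ p * C ^ p / ε := by
    rw [Real.div_rpow (by positivity) (by positivity), Real.mul_rpow (by norm_num) hC.le,
      ← Real.rpow_mul hε0.le, one_div_mul_cancel hp0.ne', Real.rpow_one]
  rw [e, one_div_div]
  apply div_le_div₀ (by linarith) (by linarith) (by positivity)
  calc 4 * C ^ p * (p + 1) = 4 * (p + 1) * C ^ p := by ring
    _ ≤ _ := by gcongr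

theorem hasPowerTypeModulus_of_rpow_midpoint_le {N : Seminorm 𝕜 X} {c : ℝ} (hp : 1 ≤ p)
    (hc : ∀ x y, N ((2⁻¹ : 𝕜) • (x + y)) ^ p ≤
      (N x ^ p + N y ^ p) / 2 - c * N ((2⁻¹ : 𝕜) • (x - y)) ^ p) :
    HasPowerTypeModulus N p (c / 2 ^ p / p) := by
  intro x y hx hy
  have h := hc x y
  have hp0 : 0 < p := by linarith
  set m := N ((2⁻¹ : 𝕜) • (x + y)) with hm
  have hm0 : 0 ≤ m := apply_nonneg N _
  have hb := one_add_mul_self_le_rpow_one_add (s := m - 1) (p := p) (by linarith) hp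
  rw [hx, hy, Real.one_rpow, N.apply_inv_two_smul (x - y),
    Real.div_rpow (apply_nonneg _ _) (by norm_num)] at h
  rw [add_sub_cancel] at hb
  have e : c / 2 ^ p / p * N (x - y) ^ p = (c * (N (x - y) ^ p / 2 ^ p)) / p := by ring
  rw [e, le_sub_comm, div_le_iff₀ hp0]
  linarith

end Final

theorem theorem1p2 (𝕜 : Type w) [RCLike 𝕜] (X : Type u) [NormedAddCommGroup X]
    [NormedSpace 𝕜 X] [CompleteSpace X] (p : ℝ) (hp : 2 ≤ p) :
    -- `p`-convexity and Markov `p`-convexity coincide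
    (IsPConvex 𝕜 X p ↔ IsMarkovConvex.{u, v} X p) ∧
    -- quantitative form of the forward direction
    (∀ K : ℝ≥0, 0 < K → TwoPointInequality (normSeminorm 𝕜 X) p K →
      IsMarkovConvexWith.{u, v} X p (4 * K)) ∧
    -- quantitative form of the converse
    (∀ C : ℝ≥0, 0 < C → IsMarkovConvexWith.{u, v} X p C →
      ∀ ε : ℝ, 0 < ε → ε < 1 →
        ∃ N : Seminorm 𝕜 X,
          (∀ x, (1 - ε) * ‖x‖ ≤ N x ∧ N x ≤ ‖x‖) ∧
          (∀ x y, N ((2⁻¹ : 𝕜) • (x + y)) ^ p ≤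
            (N x ^ p + N y ^ p) / 2
              - (1 - (1 - ε) ^ p) / (4 * (C : ℝ) ^ p * (p + 1)) * N ((2⁻¹ : 𝕜) • (x - y)) ^ p) ∧
          TwoPointInequality N p (4 * C / ε ^ (1 / p))) := by
  have hp1 : 1 ≤ p := by linarith
  refine ⟨⟨?_, ?_⟩, ?_, ?_⟩
  · rintro ⟨N, ⟨a, b, ha, hb, hN⟩, K, hK, h⟩
    obtain ⟨K', hK', h'⟩ := h.exists_twoPointInequality hK hp
    lift a to ℝ≥0 using ha.le
    lift b to ℝ≥0 using hb.le
    exact ⟨_, h'.isMarkovConvexWith (a := a) (b := b) (by exact_mod_cast ha) hN hK' hp1⟩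
  · rintro ⟨C, hC⟩
    obtain ⟨N, hN, hmid⟩ := (hC.mono (C' := C + 1) (by linarith) le_self_add).exists_seminorm
      (𝕜 := 𝕜) hp1 (by positivity) (ε := 1 / 2) (by norm_num) (by norm_num)
    refine ⟨N, ⟨1 / 2, 1, by norm_num, one_pos, fun x ↦ ?_⟩, _, ?_,
      hasPowerTypeModulus_of_rpow_midpoint_le hp1 hmid⟩
    · have := hN x
      constructor <;> linarith
    · have h1 : (1 - 1 / 2 : ℝ) ^ p < 1 := Real.rpow_lt_one (by norm_num) (by norm_num) (by linarith)
      have h2 : 0 < 1 - (1 - 1 / 2 : ℝ) ^ p := by linarith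
      positivity
  · intro K hK h
    have := h.isMarkovConvexWith.{u, v} (a := 1) (b := 1) one_pos (fun x ↦ by simp) hK hp1
    simpa using this
  · intro C hC h ε hε0 hε1
    obtain ⟨N, hN, hmid⟩ := h.exists_seminorm (𝕜 := 𝕜) hp1 hC hε0 hε1
    exact ⟨N, hN, hmid, twoPointInequality_of_rpow_midpoint_le hmid
      (one_div_rpow_le_renorming_constant hp hC hε0 hε1)⟩
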